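/- Work in $\mathrm{ZF}$ (equivalently, in an arbitrary model $(V,\in)$ of the first-order theory $\mathrm{ZF}$, with all set-theoretic notions, including formulas and satisfaction for set structures, interpreted in $V$). A nonzero cardinal $\delta$ is a \emph{Berkeley cardinal} if for every transitive set $M$ with $\delta\in M$ and every ordinal $\eta<\delta$ there is an elementary embedding $j:(M,\in)\to(M,\in)$ that moves some ordinal and whose critical point (the least ordinal moved) satisfies $\eta<\mathrm{crit}(j)<\delta$. Let $\delta$ be a Berkeley cardinal. Let $\mathcal M_\delta$ be the class of all transitive sets $M$ with $\delta\in M$ (the \emph{worlds}), and for $M,N\in\mathcal M_\delta$ let $M\mathrel{\mathcal R}N$ hold iff $M\subseteq N$ and for every elementary embedding $j:N\to N$ the restriction $j\restriction M$ is an elementary embedding $M\to M$. Assertions of the potentialist language $\mathrm{ZF}^\Diamond$ are built from $\in$, $=$, the Boolean connectives, the quantifiers and the modal operators $\Box,\Diamond$. At a world $M$, quantifiers range over the elements of $M$; $\Box\psi$ (respectively $\Diamond\psi$) holds at $M$ iff $\psi$ holds at every (respectively some) world $N$ with $M\mathrel{\mathcal R}N$. A propositional modal formula $\varphi(p_0,\dots,p_n)$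 is \emph{valid} in $\langle\mathcal M_\delta,\mathcal R\rangle$ for a class of assertions if at every world $M$ every substitution instance $\varphi(\psi_0,\dots,\psi_n)$ by assertions $\psi_i$ from the class (with parameters, if allowed, taken from $M$) is true at $M$. $\mathrm{S4.2}$ is the set of propositional modal formulas obtained from all classical propositional tautologies and all instances of (K) $\Box(\varphi\to\psi)\to(\Box\varphi\to\Box\psi)$, (Dual) $\neg\Diamond\varphi\leftrightarrow\Box\neg\varphi$, (S) $\Box\varphi\to\varphi$, (4) $\Box\varphi\to\Box\Box\varphi$ and (.2) $\Diamond\Box\varphi\to\Box\Diamond\varphi$ by closing under modus ponens and necessitation. \textbf{Theorem.} The modal logic of $\langle\mathcal M_\delta,\mathcal R\rangle$ is exactly $\mathrm{S4.2}$: for every propositional modal formula $\varphi$, $\varphi$ is valid in $\langle\mathcal M_\delta,\mathcal R\rangle$ for all assertions of $\mathrm{ZF}^\Diamond$ with parameters if and only if $\varphi\in\mathrm{S4.2}$. The same equivalence holds for validity for sentences of the language of set theory without parameters and without modal operators. -/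

import Mathlib

open FirstOrder

namespace Potentialism

universe u

/-! ### Models of ZF -/

/-- The only non-logical symbol of the language of set theory: a binary relation symbol. -/
inductive SetRel : ℕ → Type
  | mem : SetRel 2

/-- The language of set theory. -/
def setLang : FirstOrder.Language := ⟨fun _ => Empty, SetRel⟩

/-- Membership in a structure for the language of set theory. -/
def Mem {V : Type u} [setLang.Structure V] (x y : V) : Prop :=
  FirstOrder.Language.Structure.RelMap (L := setLang) SetRel.mem ![x, y]

infix:50 " ∈ᵥ " => Potentialism.Mem

section Internal

variable {V : Type u} [setLang.Structure V]

/-- `x` is empty. -/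
def IsEmptySet (x : V) : Prop := ∀ z, ¬ z ∈ᵥ x

/-- `x ⊆ y`. -/
def Sub (x y : V) : Prop := ∀ z, z ∈ᵥ x → z ∈ᵥ y

/-- `p = {a, b}`. -/
def IsUPair (p a b : V) : Prop := ∀ z, z ∈ᵥ p ↔ z = a ∨ z = b

/-- `s = a ∪ {a}`. -/
def IsSucc (s a : V) : Prop := ∀ z, z ∈ᵥ s ↔ z ∈ᵥ a ∨ z = a

/-- `u` contains the empty set and is closed under successor. -/
def IsInductive (u : V) : Prop :=
  (∀ x, IsEmptySet x → x ∈ᵥ u) ∧ ∀ x s, x ∈ᵥ u → IsSucc s x → s ∈ᵥ u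

variable (V) in
/-- `V` is a model of the (first-order) theory ZF. In the two schemes, "definable" means
first-order definable over `V` with arbitrary parameters from `V`. -/
structure IsModelZF : Prop where
  extensionality : ∀ x y : V, (∀ z, z ∈ᵥ x ↔ z ∈ᵥ y) → x = y
  foundation : ∀ x : V, (∃ y, y ∈ᵥ x) → ∃ y, y ∈ᵥ x ∧ ∀ z, z ∈ᵥ y → ¬ z ∈ᵥ x
  pairing : ∀ a b : V, ∃ p, IsUPair p a b
  union : ∀ a : V, ∃ b, ∀ z, z ∈ᵥ b ↔ ∃ y, y ∈ᵥ a ∧ z ∈ᵥ y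
  powerset : ∀ a : V, ∃ b, ∀ z, z ∈ᵥ b ↔ Sub z a
  infinity : ∃ w : V, (∃ x, IsEmptySet x ∧ x ∈ᵥ w) ∧
    ∀ x, x ∈ᵥ w → ∃ s, IsSucc s x ∧ s ∈ᵥ w
  separation : ∀ S : Set V, (Set.univ : Set V).Definable₁ setLang S →
    ∀ a : V, ∃ b, ∀ z, z ∈ᵥ b ↔ z ∈ᵥ a ∧ z ∈ S
  replacement : ∀ F : Set (V × V), (Set.univ : Set V).Definable₂ setLang F →
    ∀ a : V, (∀ x, x ∈ᵥ a → ∃! y, (x, y) ∈ F) → ∃ b, ∀ y, y ∈ᵥ b ↔ ∃ x, x ∈ᵥ a ∧ (x, y) ∈ F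

/-! ### Basic set-theoretic notions, interpreted in `V` -/

/-- `p` is the Kuratowski pair `{{a}, {a, b}}`. -/
def IsOPair (p a b : V) : Prop :=
  ∃ s t, IsUPair s a a ∧ IsUPair t a b ∧ IsUPair p s t

/-- The ordered pair `(x, y)` is an element of `r`. -/
def PairMem (r x y : V) : Prop := ∃ p, IsOPair p x y ∧ p ∈ᵥ r

/-- `f` is a function from `a` to `b`. -/
def IsFun (f a b : V) : Prop :=
  (∀ p, p ∈ᵥ f → ∃ x y, x ∈ᵥ a ∧ y ∈ᵥ b ∧ IsOPair p x y) ∧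
    ∀ x, x ∈ᵥ a → ∃! y, PairMem f x y

/-- `f` is a bijection from `a` onto `b`. -/
def IsBij (f a b : V) : Prop :=
  IsFun f a b ∧ ∀ y, y ∈ᵥ b → ∃! x, PairMem f x y

/-- `x` is a transitive set. -/
def IsTrans (x : V) : Prop := ∀ y, y ∈ᵥ x → Sub y x

/-- `x` is a (von Neumann) ordinal. -/
def IsOrd (x : V) : Prop := IsTrans x ∧ ∀ y, y ∈ᵥ x → IsTrans y

/-- `x` is a cardinal: an ordinal not in bijection with any smaller ordinal. -/
def IsCard (x : V) : Prop := IsOrd x ∧ ∀ a, a ∈ᵥ x → ¬ ∃ f, IsBij f a x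

/-- `n` is a natural number of `V`. -/
def IsNat (n : V) : Prop := ∀ u, IsInductive u → n ∈ᵥ u

/-- `w` is the set of natural numbers of `V`. -/
def IsOmega (w : V) : Prop := ∀ n, n ∈ᵥ w ↔ IsNat n

/-- `x` is the numeral `k` in `V`. -/
def IsNum : ℕ → V → Prop
  | 0, x => IsEmptySet x
  | k + 1, x => ∃ y, IsNum k y ∧ IsSucc x y

/-! ### Formulas and satisfaction inside `V`

Formulas of the language of set theory are coded by elements of `V` (so that `V` may have
formulas of nonstandard length, exactly as the arithmetization in ZF prescribes). The codes are
`(0, (i, j))` for `xᵢ ∈ xⱼ`, `(1, (i, j))` for `xᵢ = xⱼ`, `(2, (φ, φ))` for `¬ φ`,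
`(3, (φ, ψ))` for `φ ∧ ψ` and `(4, (i, φ))` for `∃ xᵢ, φ`. -/

/-- `c = (k, (a, b))`. -/
def IsCode (k : ℕ) (a b c : V) : Prop :=
  ∃ t p, IsNum k t ∧ IsOPair p a b ∧ IsOPair c t p

/-- `X` contains the atomic formulas and is closed under the formation rules. -/
def FormClosed (X : V) : Prop :=
  (∀ i j c, IsNat i → IsNat j → IsCode 0 i j c → c ∈ᵥ X) ∧
  (∀ i j c, IsNat i → IsNat j → IsCode 1 i j c → c ∈ᵥ X) ∧
  (∀ φ c, φ ∈ᵥ X → IsCode 2 φ φ c → c ∈ᵥ X) ∧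
  (∀ φ ψ c, φ ∈ᵥ X → ψ ∈ᵥ X → IsCode 3 φ ψ c → c ∈ᵥ X) ∧
  (∀ i φ c, IsNat i → φ ∈ᵥ X → IsCode 4 i φ c → c ∈ᵥ X)

/-- `φ` is (the code of) a formula in the sense of `V`. -/
def IsForm (φ : V) : Prop := ∀ X, FormClosed X → φ ∈ᵥ X

/-- `a` is an assignment of elements of `M` to the variables: a function from `ω` to `M`. -/
def IsAsg (M a : V) : Prop := ∃ w, IsOmega w ∧ IsFun a w M

/-- The assignments `a` and `b` agree except possibly at the variable `i`. -/
def AgreeOff (i a b : V) : Prop :=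
  ∀ k, IsNat k → k ≠ i → ∀ x, PairMem a k x ↔ PairMem b k x

/-- `S` is a satisfaction relation for the structure `(M, ∈)`: it obeys Tarski's clauses. -/
def IsSatRel (M S : V) : Prop :=
  ∀ a, IsAsg M a →
    (∀ i j c, IsNat i → IsNat j → IsCode 0 i j c →
      (PairMem S c a ↔ ∃ x y, PairMem a i x ∧ PairMem a j y ∧ x ∈ᵥ y)) ∧
    (∀ i j c, IsNat i → IsNat j → IsCode 1 i j c →
      (PairMem S c a ↔ ∃ x, PairMem a i x ∧ PairMem a j x)) ∧
    (∀ φ c, IsForm φ → IsCode 2 φ φ c → (PairMem S c a ↔ ¬ PairMem S φ a)) ∧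
    (∀ φ ψ c, IsForm φ → IsForm ψ → IsCode 3 φ ψ c →
      (PairMem S c a ↔ PairMem S φ a ∧ PairMem S ψ a)) ∧
    (∀ i φ c, IsNat i → IsForm φ → IsCode 4 i φ c →
      (PairMem S c a ↔ ∃ b, IsAsg M b ∧ AgreeOff i a b ∧ PairMem S φ b))

/-- `(M, ∈) ⊨ φ[a]` in the sense of `V`. -/
def Sat (M φ a : V) : Prop := ∃ S, IsSatRel M S ∧ PairMem S φ a

/-- `j` is (in the sense of `V`) an elementary embedding from `(M, ∈)` to `(N, ∈)`. -/
def IsElemEmb (j M N : V) : Prop :=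
  IsFun j M N ∧ ∀ φ a b, IsForm φ → IsAsg M a → IsAsg N b →
    (∀ k x y, PairMem a k x → PairMem b k y → PairMem j x y) →
    (Sat M φ a ↔ Sat N φ b)

/-! ### Berkeley cardinals and the potentialist system -/

/-- `κ` is the critical point of `j`: the least ordinal moved by `j`. -/
def IsCrit (j κ : V) : Prop :=
  IsOrd κ ∧ (∃ y, PairMem j κ y ∧ y ≠ κ) ∧ ∀ α, α ∈ᵥ κ → PairMem j α α

/-- `δ` is a Berkeley cardinal. (The degenerate value `δ = 0`, for which the main clause is
void, is excluded.) -/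
def IsBerkeley (δ : V) : Prop :=
  IsCard δ ∧ ¬ IsEmptySet δ ∧
    ∀ M, IsTrans M → δ ∈ᵥ M → ∀ η, η ∈ᵥ δ →
      ∃ j κ, IsElemEmb j M M ∧ IsCrit j κ ∧ η ∈ᵥ κ ∧ κ ∈ᵥ δ

/-- The worlds: transitive sets having `δ` as an element. -/
def IsWorld (δ M : V) : Prop := IsTrans M ∧ δ ∈ᵥ M

/-- The accessibility relation: `M ⊆ N` and every elementary `j : N → N` lifts some elementary
`j' : M → M`, that is, `j ↾ M = j'`. -/
def Accesses (M N : V) : Prop :=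
  Sub M N ∧ ∀ j, IsElemEmb j N N →
    ∃ j', IsElemEmb j' M M ∧ ∀ x, x ∈ᵥ M → ∀ y, PairMem j' x y ↔ PairMem j x y

end Internal

/-! ### The potentialist language -/

/-- Formulas of the language of set theory augmented by the modal operators `□` and `◇`, with
parameters (constants) from `A` and with `n` free variables. The other connectives and `∃` are
definable as usual. -/
inductive PotFormula (A : Type u) : ℕ → Type u
  | mem {n : ℕ} (s t : A ⊕ Fin n) : PotFormula A n
  | eq {n : ℕ} (s t : A ⊕ Fin n) : PotFormula A n
  | falsum {n : ℕ} : PotFormula A n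
  | imp {n : ℕ} (φ ψ : PotFormula A n) : PotFormula A n
  | all {n : ℕ} (φ : PotFormula A (n + 1)) : PotFormula A n
  | box {n : ℕ} (φ : PotFormula A n) : PotFormula A n
  | dia {n : ℕ} (φ : PotFormula A n) : PotFormula A n

namespace PotFormula

/-- The formula is in the language of set theory (no modal operators) and has no parameters. -/
def IsPureZF {A : Type u} : {n : ℕ} → PotFormula A n → Prop
  | _, mem s t => s.isRight ∧ t.isRight
  | _, eq s t => s.isRight ∧ t.isRight
  | _, falsum => True
  | _, imp φ ψ => IsPureZF φ ∧ IsPureZF ψ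
  | _, all φ => IsPureZF φ
  | _, box _ => False
  | _, dia _ => False

/-- Truth at a world `M` of the potentialist system of `δ`; parameters are interpreted by `v`
and free variables by `x`. Quantifiers range over the elements of the current world. -/
def Holds {V : Type u} [setLang.Structure V] (δ : V) {A : Type u} (v : A → V) :
    {n : ℕ} → PotFormula A n → V → (Fin n → V) → Prop
  | _, mem s t, _, x => Sum.elim v x s ∈ᵥ Sum.elim v x t
  | _, eq s t, _, x => Sum.elim v x s = Sum.elim v x t
  | _, falsum, _, _ => False
  | _, imp φ ψ, M, x => Holds δ v φ M x → Holds δ v ψ M x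
  | _, all φ, M, x => ∀ y, y ∈ᵥ M → Holds δ v φ M (Fin.snoc x y)
  | _, box φ, M, x => ∀ N, IsWorld δ N → Accesses M N → Holds δ v φ N x
  | _, dia φ, M, x => ∃ N, IsWorld δ N ∧ Accesses M N ∧ Holds δ v φ N x

end PotFormula

/-! ### Propositional modal logic and S4.2 -/

/-- Formulas of propositional modal logic. -/
inductive ModalFormula : Type
  | var (i : ℕ) : ModalFormula
  | falsum : ModalFormula
  | imp (φ ψ : ModalFormula) : ModalFormula
  | box (φ : ModalFormula) : ModalFormula
  | dia (φ : ModalFormula) : ModalFormula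

namespace ModalFormula

/-- Negation. -/
def neg (φ : ModalFormula) : ModalFormula := imp φ falsum

/-- Conjunction. -/
def and (φ ψ : ModalFormula) : ModalFormula := neg (imp φ (neg ψ))

/-- Equivalence. -/
def iff (φ ψ : ModalFormula) : ModalFormula := and (imp φ ψ) (imp ψ φ)

/-- `φ` is an instance of a classical propositional tautology: it is true under every truth
assignment that treats variables and formulas beginning with a modal operator as atoms. -/
def IsTautology (φ : ModalFormula) : Prop :=
  ∀ v : ModalFormula → Prop, ¬ v falsum → (∀ α β, v (imp α β) ↔ (v α → v β)) → v φ

/-- Substitution of assertions of the potentialist language for the propositional variables. -/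
def subst {A : Type u} {n : ℕ} (σ : ℕ → PotFormula A n) : ModalFormula → PotFormula A n
  | var i => σ i
  | falsum => .falsum
  | imp φ ψ => .imp (subst σ φ) (subst σ ψ)
  | box φ => .box (subst σ φ)
  | dia φ => .dia (subst σ φ)

end ModalFormula

open ModalFormula in
/-- The modal theory S4.2: the closure of the classical tautologies and the axioms (K), (Dual),
(S), (4) and (.2) under modus ponens and necessitation. -/
inductive S42 : ModalFormula → Prop
  | taut {φ : ModalFormula} (h : IsTautology φ) : S42 φ
  | axK (φ ψ : ModalFormula) : S42 (imp (box (imp φ ψ)) (imp (box φ) (box ψ)))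
  | axDual (φ : ModalFormula) : S42 (iff (neg (dia φ)) (box (neg φ)))
  | axS (φ : ModalFormula) : S42 (imp (box φ) φ)
  | ax4 (φ : ModalFormula) : S42 (imp (box φ) (box (box φ)))
  | axDot2 (φ : ModalFormula) : S42 (imp (dia (box φ)) (box (dia φ)))
  | mp {φ ψ : ModalFormula} (h₁ : S42 (imp φ ψ)) (h₂ : S42 φ) : S42 ψ
  | nec {φ : ModalFormula} (h : S42 φ) : S42 (box φ)

/-! ### Validity -/

/-- Assertions that may be made at the world `M`: sentences of the potentialist language with
parameters from `M`. -/
abbrev Assertion {V : Type u} [setLang.Structure V] (M : V) : Type u :=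
  PotFormula {a : V // a ∈ᵥ M} 0

/-- Truth of an assertion at the world `M` of the potentialist system of `δ`. -/
def TrueAt {V : Type u} [setLang.Structure V] (δ M : V) (ψ : Assertion M) : Prop :=
  ψ.Holds δ Subtype.val M Fin.elim0

/-- `φ` is valid at `M` for the class `C` of assertions: all its substitution instances by
assertions from `C` are true at `M`. -/
def ValidAt {V : Type u} [setLang.Structure V] (δ M : V) (C : Set (Assertion M))
    (φ : ModalFormula) : Prop :=
  ∀ σ : ℕ → Assertion M, (∀ i, σ i ∈ C) → TrueAt δ M (φ.subst σ)

/-- `φ` is valid in the potentialist system of `δ` for all assertions of the potentialist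
language with parameters. -/
def Valid {V : Type u} [setLang.Structure V] (δ : V) (φ : ModalFormula) : Prop :=
  ∀ M, IsWorld δ M → ValidAt δ M Set.univ φ

/-- `φ` is valid in the potentialist system of `δ` for sentences of the language of set theory
without parameters. -/
def ValidPureZF {V : Type u} [setLang.Structure V] (δ : V) (φ : ModalFormula) : Prop :=
  ∀ M, IsWorld δ M → ValidAt δ M {ψ | ψ.IsPureZF} φ

end Potentialism

/-! Soundness amounts to accessibility being reflexive, transitive and directed; only directedness
needs work. Completeness is a buttons-and-dial argument: any finite countermodel of the kind
characterizing S4.2 is simulated by the worlds above some world. One construction serves both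
halves.

Extension. Given worlds `M₁`, `M₂`, choose a transitive set `T` containing them together with their
sets of assignments and their satisfaction relations `S₁`, `S₂`, and bundle these six objects and a
natural number `d` into one ordered pair `Z ∈ T` with first component `d`. Put `N = T ∪ {T, {T, Z}}`
(`cap`). The set `{T, Z}` is the only element of `N` that belongs to no element of `N`, so every
elementary `j : N → N` fixes it; as `Z ∈ T`, foundation forces `j` to fix `Z`, hence all its
components. Natural numbers and formulas are fixed as well, and `j(a) = j ∘ a` for an assignment
`a`. Since `(M, ∈) ⊨ φ[a]` is the statement `(φ, a) ∈ S` with `S` fixed, `j` restricts to an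
elementary self-map of each `Mᵢ` (`exists_restrict`). Thus both worlds access `N`
(`exists_accesses`).

Control statements. Button `k` says that `{0, 1, k + 3}` exists; in transitive worlds it stays true
once true. Dial `k` says that some pair with first component `k` lies in a maximal set; in `cap T Z`
it holds exactly when `k = d`, so the dial can be reset at will. For independence, `T` must omit
chosen button sets. These are "wild": they contain `∅` and are neither transitive nor unordered
pairs, whereas each set needed for the coding lacks `∅`, is transitive, or is an unordered pair.
Hence prescribed unpushed buttons can be kept out while the others are pushed (`exists_push`).

Modal side. Filtration of the canonical model refutes each non-theorem of S4.2 at the root of a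
finite directed preorder `W` (`exists_finite_countermodel`). Such a `W` is a bounded morphic image
of the subsets of `W`, each carrying a cluster indexed by `W` (`exists_state_map`). Pushed buttons
give the subset and the dial gives the cluster point, so worlds are labelled by points of `W`, and
the valuation becomes Boolean combinations of buttons and dials, which are parameter-free
first-order sentences. -/

namespace Potentialism

universe u

/-! ### Propositional modal logic: S4.2 and finite directed preorders -/

namespace ModalFormula

/-- Kripke forcing on a preorder. -/
def Forces {W : Type*} [Preorder W] (val : ℕ → W → Prop) : ModalFormula → W → Prop
  | var i, w => val i w
  | falsum, _ => False
  | imp φ ψ, w => Forces val φ w → Forces val ψ w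
  | box φ, w => ∀ u, w ≤ u → Forces val φ u
  | dia φ, w => ∃ u, w ≤ u ∧ Forces val φ u

/-- The set of subformulas. -/
def subformulas : ModalFormula → Set ModalFormula
  | var i => {var i}
  | falsum => {falsum}
  | imp φ ψ => {imp φ ψ} ∪ (subformulas φ ∪ subformulas ψ)
  | box φ => {box φ} ∪ subformulas φ
  | dia φ => {dia φ} ∪ subformulas φ

theorem finite_subformulas (φ : ModalFormula) : φ.subformulas.Finite := by
  induction φ with
  | var i => exact Set.finite_singleton _
  | falsum => exact Set.finite_singleton _
  | imp φ ψ h₁ h₂ => exact (Set.finite_singleton _).union (h₁.union h₂)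
  | box φ h => exact (Set.finite_singleton _).union h
  | dia φ h => exact (Set.finite_singleton _).union h

/-- Derivability from hypotheses over S4.2, with modus ponens as the only rule. -/
inductive Derives (Γ : Set ModalFormula) : ModalFormula → Prop
  | hyp {φ} (h : φ ∈ Γ) : Derives Γ φ
  | thm {φ} (h : S42 φ) : Derives Γ φ
  | mp {φ ψ} (h₁ : Derives Γ (imp φ ψ)) (h₂ : Derives Γ φ) : Derives Γ ψ

theorem Derives.mono {Γ Δ : Set ModalFormula} (h : Γ ⊆ Δ) {φ} (d : Derives Γ φ) :
    Derives Δ φ := by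
  induction d with
  | hyp h' => exact .hyp (h h')
  | thm h' => exact .thm h'
  | mp _ _ h₁ h₂ => exact .mp h₁ h₂

theorem Derives.taut {Γ : Set ModalFormula} {φ} (h : IsTautology φ) : Derives Γ φ :=
  .thm (.taut h)

theorem derives_empty {φ} (d : Derives ∅ φ) : S42 φ := by
  induction d with
  | hyp h => exact h.elim
  | thm h => exact h
  | mp _ _ h₁ h₂ => exact .mp h₁ h₂

/-- A form of the deduction theorem: the hypotheses taken from `A` may be collected into one. -/
theorem Derives.collect {A Γ : Set ModalFormula} {φ} (d : Derives (A ∪ Γ) φ)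
    (htop : imp falsum falsum ∈ A) (hand : ∀ α ∈ A, ∀ β ∈ A, and α β ∈ A) :
    ∃ χ ∈ A, Derives Γ (imp χ φ) := by
  induction d with
  | @hyp φ h =>
    rcases h with h | h
    · exact ⟨φ, h, .taut fun v h0 hi => by simp [hi]⟩
    · exact ⟨_, htop, .mp (.taut fun v h0 hi => by simp only [hi]; tauto) (.hyp h)⟩
  | @thm φ h =>
    exact ⟨_, htop, .mp (.taut fun v h0 hi => by simp only [hi]; tauto) (.thm h)⟩
  | @mp φ ψ _ _ h₁ h₂ =>
    obtain ⟨χ₁, m₁, d₁⟩ := h₁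
    obtain ⟨χ₂, m₂, d₂⟩ := h₂
    refine ⟨and χ₁ χ₂, hand _ m₁ _ m₂, .mp (.mp (.taut fun v h0 hi => ?_) d₁) d₂⟩
    simp only [hi, ModalFormula.and, neg, h0]; tauto

theorem Derives.deduction {Γ : Set ModalFormula} {φ ψ} (d : Derives (insert ψ Γ) φ) :
    Derives Γ (imp ψ φ) := by
  induction d with
  | hyp h =>
    rcases h with rfl | h
    · exact .taut fun v h0 hi => by simp [hi]
    · exact .mp (.taut fun v h0 hi => by simp only [hi]; tauto) (.hyp h)
  | thm h => exact .mp (.taut fun v h0 hi => by simp only [hi]; tauto) (.thm h)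
  | mp _ _ h₁ h₂ => exact .mp (.mp (.taut fun v h0 hi => by simp only [hi]; tauto) h₁) h₂

/-- Complete theories extending S4.2. -/
structure IsComplete (Γ : Set ModalFormula) : Prop where
  thm {φ} : S42 φ → φ ∈ Γ
  falsum : falsum ∉ Γ
  imp {φ ψ} : imp φ ψ ∈ Γ ↔ (φ ∈ Γ → ψ ∈ Γ)

/-- Lindenbaum's argument, with Zorn applied to the theories that do not derive `φ`. A maximal such
`Δ` derives `ψ → φ` for every `ψ ∉ Δ`, which makes it deductively closed and complete. -/
theorem exists_isComplete {Γ : Set ModalFormula} {φ} (h : ¬ Derives Γ φ) :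
    ∃ Δ, Γ ⊆ Δ ∧ IsComplete Δ ∧ φ ∉ Δ := by
  obtain ⟨Δ, hΓΔ, hmax⟩ := zorn_subset_nonempty {Δ | ¬ Derives Δ φ} (by
    intro c hc hchain ⟨Δ₀, hΔ₀⟩
    refine ⟨⋃₀ c, ?_, fun s hs => Set.subset_sUnion_of_mem hs⟩
    have key : ∀ ψ, Derives (⋃₀ c) ψ → ∃ Δ ∈ c, Derives Δ ψ := by
      intro ψ d
      induction d with
      | hyp h => obtain ⟨Δ, hΔ, h⟩ := h; exact ⟨Δ, hΔ, .hyp h⟩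
      | thm h => exact ⟨Δ₀, hΔ₀, .thm h⟩
      | mp _ _ h₁ h₂ =>
        obtain ⟨Δ₁, m₁, d₁⟩ := h₁
        obtain ⟨Δ₂, m₂, d₂⟩ := h₂
        rcases hchain.total m₁ m₂ with hs | hs
        · exact ⟨Δ₂, m₂, .mp (d₁.mono hs) d₂⟩
        · exact ⟨Δ₁, m₁, .mp d₁ (d₂.mono hs)⟩
    intro d
    obtain ⟨Δ, hΔ, d⟩ := key φ d
    exact hc hΔ d) Γ h
  have hnot : ¬ Derives Δ φ := hmax.prop
  have hins : ∀ ψ, ψ ∉ Δ → Derives Δ (.imp ψ φ) := by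
    intro ψ hψ
    by_contra hcon
    have : insert ψ Δ ⊆ Δ :=
      hmax.le_of_ge (y := insert ψ Δ) (fun d => hcon d.deduction) (Set.subset_insert _ _)
    exact hψ (this (Set.mem_insert _ _))
  have hcl : ∀ ψ, Derives Δ ψ → ψ ∈ Δ := by
    intro ψ d
    by_contra hψ
    exact hnot (.mp (hins ψ hψ) d)
  refine ⟨Δ, hΓΔ, ⟨fun h => hcl _ (.thm h), fun h => ?_, fun {α β} => ⟨fun h₁ h₂ => ?_, fun h => ?_⟩⟩,
    fun h => hnot (.hyp h)⟩
  · exact hnot (.mp (.taut fun v h0 hi => by simp [hi, h0]) (.hyp h))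
  · exact hcl _ (.mp (.hyp h₁) (.hyp h₂))
  · by_cases hα : α ∈ Δ
    · exact hcl _ (.mp (.taut fun v h0 hi => by simp only [hi]; tauto) (.hyp (h hα)))
    · by_contra hcon
      -- Peirce's law in disguise: if both `α` and `α → β` imply `φ`, then `φ` holds.
      refine hnot (.mp (.mp (.taut fun v h0 hi => ?_) (hins _ hα)) (hins _ hcon))
      simp only [hi]; tauto

theorem IsComplete.neg {Γ : Set ModalFormula} (hΓ : IsComplete Γ) {φ} :
    neg φ ∈ Γ ↔ φ ∉ Γ := by
  simp [ModalFormula.neg, hΓ.imp, hΓ.falsum]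

theorem IsComplete.and {Γ : Set ModalFormula} (hΓ : IsComplete Γ) {φ ψ} :
    and φ ψ ∈ Γ ↔ φ ∈ Γ ∧ ψ ∈ Γ := by
  simp [ModalFormula.and, hΓ.neg, hΓ.imp]

theorem IsComplete.dia {Γ : Set ModalFormula} (hΓ : IsComplete Γ) {φ} :
    dia φ ∈ Γ ↔ box (ModalFormula.neg φ) ∉ Γ := by
  have h := hΓ.thm (S42.axDual φ)
  simp only [ModalFormula.iff, hΓ.and, hΓ.imp, hΓ.neg] at h
  tauto

/-- Accessibility in the canonical model. -/
def CanonicalLE (Γ Δ : Set ModalFormula) : Prop := ∀ ψ, box ψ ∈ Γ → ψ ∈ Δ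

/-- Modus ponens is the only rule of `Derives`, so (K) carries the box through a derivation;
necessitation is applied to theorems only. -/
theorem IsComplete.box_derives {Γ : Set ModalFormula} (hΓ : IsComplete Γ) {φ}
    (d : Derives {ψ | box ψ ∈ Γ} φ) : box φ ∈ Γ := by
  induction d with
  | hyp h => exact h
  | thm h => exact hΓ.thm (.nec h)
  | mp _ _ h₁ h₂ => exact hΓ.imp.1 (hΓ.imp.1 (hΓ.thm (.axK _ _)) h₁) h₂

theorem IsComplete.exists_of_box {Γ : Set ModalFormula} (hΓ : IsComplete Γ) {φ}
    (h : box φ ∉ Γ) : ∃ Δ, IsComplete Δ ∧ CanonicalLE Γ Δ ∧ φ ∉ Δ := by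
  obtain ⟨Δ, h₁, h₂, h₃⟩ := exists_isComplete fun d => h (hΓ.box_derives (φ := φ) d)
  exact ⟨Δ, h₂, fun ψ hψ => h₁ hψ, h₃⟩

theorem IsComplete.le_dia {Γ Δ : Set ModalFormula} (hΓ : IsComplete Γ) (hΔ : IsComplete Δ)
    (h : CanonicalLE Γ Δ) {φ} (hφ : φ ∈ Δ) : ModalFormula.dia φ ∈ Γ :=
  hΓ.dia.2 fun h' => hΔ.neg.1 (h _ h') hφ

theorem IsComplete.le_box {Γ Δ : Set ModalFormula} (hΓ : IsComplete Γ)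
    (h : CanonicalLE Γ Δ) {φ} (hφ : box φ ∈ Γ) : box φ ∈ Δ :=
  h _ (hΓ.imp.1 (hΓ.thm (.ax4 φ)) hφ)

theorem IsComplete.trans {Γ Δ Θ : Set ModalFormula} (hΓ : IsComplete Γ)
    (h₁ : CanonicalLE Γ Δ) (h₂ : CanonicalLE Δ Θ) : CanonicalLE Γ Θ :=
  fun _ h => h₂ _ (hΓ.le_box h₁ h)

theorem IsComplete.refl {Γ : Set ModalFormula} (hΓ : IsComplete Γ) : CanonicalLE Γ Γ :=
  fun ψ h => hΓ.imp.1 (hΓ.thm (.axS ψ)) h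

/-- This is where (.2) acts. If the boxed parts of `Δ₁` and `Δ₂` were jointly inconsistent, some `χ`
would have `□χ ∈ Δ₁` and `□¬χ ∈ Δ₂`; but `◇□χ ∈ Γ` yields `□◇χ ∈ Γ`, hence `◇χ ∈ Δ₂`. -/
theorem IsComplete.exists_upper {Γ Δ₁ Δ₂ : Set ModalFormula} (hΓ : IsComplete Γ)
    (hΔ₁ : IsComplete Δ₁) (hΔ₂ : IsComplete Δ₂) (h₁ : CanonicalLE Γ Δ₁)
    (h₂ : CanonicalLE Γ Δ₂) :
    ∃ Θ, IsComplete Θ ∧ CanonicalLE Δ₁ Θ ∧ CanonicalLE Δ₂ Θ := by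
  have hcons : ¬ Derives ({ψ | box ψ ∈ Δ₁} ∪ {ψ | box ψ ∈ Δ₂}) ModalFormula.falsum := by
    intro d
    obtain ⟨χ, hχ, d⟩ := d.collect
      (hΔ₁.box_derives (.taut fun v h0 hi => by simp [hi])) (fun α hα β hβ =>
        hΔ₁.box_derives (.mp (.mp (.taut fun v h0 hi => by
          simp only [ModalFormula.and, ModalFormula.neg, hi]; tauto) (.hyp hα)) (.hyp hβ)))
    have h3 : box (ModalFormula.neg χ) ∈ Δ₂ := hΔ₂.box_derives d
    have h4 := hΓ.imp.1 (hΓ.thm (.axDot2 χ)) (hΓ.le_dia hΔ₁ h₁ hχ)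
    exact hΔ₂.dia.1 (h₂ _ h4) h3
  obtain ⟨Θ, h, hΘ, _⟩ := exists_isComplete hcons
  exact ⟨Θ, hΘ, fun ψ hψ => h (Or.inl hψ), fun ψ hψ => h (Or.inr hψ)⟩

/-- The states of the filtration: traces on `S` of complete theories above `Γ`. -/
def FiltrationState (S Γ : Set ModalFormula) : Type :=
  {s : Set S // ∃ Δ, IsComplete Δ ∧ CanonicalLE Γ Δ ∧ s = {ψ | ψ.1 ∈ Δ}}

/-- The order of the transitive filtration. `◇` is primitive and `S` need not be closed under
negation, so the clause for `◇` does not follow from the one for `□`. -/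
instance (S Γ : Set ModalFormula) : Preorder (FiltrationState S Γ) where
  le s t := (∀ ψ (h : box ψ ∈ S), ⟨_, h⟩ ∈ s.1 → (⟨_, h⟩ : S) ∈ t.1) ∧
    ∀ ψ (h : dia ψ ∈ S), ⟨_, h⟩ ∈ t.1 → (⟨_, h⟩ : S) ∈ s.1
  le_refl _ := ⟨fun _ _ h => h, fun _ _ h => h⟩
  le_trans _ _ _ h₁ h₂ :=
    ⟨fun ψ h hs => h₂.1 ψ h (h₁.1 ψ h hs), fun ψ h hs => h₁.2 ψ h (h₂.2 ψ h hs)⟩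

/-- The trace of a complete theory. -/
def trace (S : Set ModalFormula) {Γ Δ : Set ModalFormula} (hΔ : IsComplete Δ)
    (h : CanonicalLE Γ Δ) : FiltrationState S Γ := ⟨{ψ | ψ.1 ∈ Δ}, Δ, hΔ, h, rfl⟩

theorem trace_le_trace (S : Set ModalFormula) {Γ Δ₁ Δ₂ : Set ModalFormula}
    (hΔ₁ : IsComplete Δ₁) (h₁ : CanonicalLE Γ Δ₁) (hΔ₂ : IsComplete Δ₂)
    (h₂ : CanonicalLE Γ Δ₂) (h : CanonicalLE Δ₁ Δ₂) :
    trace S hΔ₁ h₁ ≤ trace S hΔ₂ h₂ := by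
  refine ⟨fun ψ _ hs => hΔ₁.le_box h hs, fun ψ _ hs => ?_⟩
  by_contra hn
  have h3 : ModalFormula.box (ModalFormula.neg ψ) ∈ Δ₁ := by
    by_contra h'
    exact hn (hΔ₁.dia.2 h')
  exact hΔ₂.dia.1 hs (hΔ₁.le_box h h3)

/-- The truth lemma. A state above the trace of `Δ` may come from a theory that is not canonically
above `Δ`; the order of the filtration still hands over `□φ` itself, and (S) then gives `φ`. -/
theorem forces_trace {S Γ : Set ModalFormula} (φ : ModalFormula)
    (hφ : φ.subformulas ⊆ S) {Δ : Set ModalFormula} (hΔ : IsComplete Δ)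
    (hΓ : IsComplete Γ) (h : CanonicalLE Γ Δ) :
    Forces (W := FiltrationState S Γ) (fun i s => ∃ h : var i ∈ S, ⟨_, h⟩ ∈ s.1) φ
      (trace S hΔ h) ↔ φ ∈ Δ := by
  induction φ generalizing Δ with
  | var i => exact ⟨fun ⟨_, h⟩ => h, fun h => ⟨hφ (Set.mem_singleton _), h⟩⟩
  | falsum => exact ⟨False.elim, fun h => hΔ.falsum h⟩
  | imp φ ψ h₁ h₂ =>
    rw [hΔ.imp, ← h₁ (fun _ hx => hφ (.inr (.inl hx))) hΔ h,
      ← h₂ (fun _ hx => hφ (.inr (.inr hx))) hΔ h]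
    rfl
  | box φ ih =>
    have hS : box φ ∈ S := hφ (.inl rfl)
    have hφS : φ.subformulas ⊆ S := fun _ hx => hφ (.inr hx)
    constructor
    · intro hf
      by_contra hn
      obtain ⟨Δ', hΔ', hle, hn'⟩ := hΔ.exists_of_box hn
      exact hn' ((ih hφS hΔ' (hΓ.trans h hle)).1
        (hf _ (trace_le_trace S hΔ h hΔ' (hΓ.trans h hle) hle)))
    · rintro hb ⟨_, Δ', hΔ', hle, rfl⟩ hu
      exact (ih hφS hΔ' hle).2 (hΔ'.refl _ (hu.1 φ hS hb))
  | dia φ ih =>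
    have hS : ModalFormula.dia φ ∈ S := hφ (.inl rfl)
    have hφS : φ.subformulas ⊆ S := fun _ hx => hφ (.inr hx)
    constructor
    · rintro ⟨⟨_, Δ', hΔ', hle, rfl⟩, hu, hf⟩
      exact hu.2 φ hS (hΔ'.le_dia hΔ' hΔ'.refl ((ih hφS hΔ' hle).1 hf))
    · intro hd
      obtain ⟨Δ', hΔ', hle, hn'⟩ := hΔ.exists_of_box (hΔ.dia.1 hd)
      refine ⟨trace S hΔ' (hΓ.trans h hle), trace_le_trace S hΔ h hΔ' (hΓ.trans h hle) hle,
        (ih hφS hΔ' _).2 ?_⟩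
      by_contra hφ'
      exact hn' (hΔ'.neg.2 hφ')

end ModalFormula

open ModalFormula

/-- The finite model property of S4.2. -/
theorem exists_finite_countermodel {φ : ModalFormula} (h : ¬ S42 φ) :
    ∃ (W : Type) (_ : Preorder W) (_ : Finite W) (r : W) (val : ℕ → W → Prop),
      (∀ w, r ≤ w) ∧ (∀ a b : W, ∃ c, a ≤ c ∧ b ≤ c) ∧ ¬ Forces val φ r := by
  obtain ⟨Γ, -, hΓ, hφ⟩ := exists_isComplete fun d => h (derives_empty d)
  have hfin : Finite φ.subformulas := φ.finite_subformulas
  -- Keeping only theories above `Γ` makes the trace of `Γ` a root and lets any two states be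
  -- amalgamated over `Γ`.
  refine ⟨FiltrationState φ.subformulas Γ, inferInstance, ?_, trace _ hΓ hΓ.refl, _, ?_, ?_,
    fun hf => hφ ((forces_trace φ subset_rfl hΓ hΓ hΓ.refl).1 hf)⟩
  · unfold FiltrationState
    infer_instance
  · rintro ⟨_, Δ, hΔ, hle, rfl⟩
    exact trace_le_trace _ hΓ hΓ.refl hΔ hle hle
  · rintro ⟨_, Δ₁, hΔ₁, h₁, rfl⟩ ⟨_, Δ₂, hΔ₂, h₂, rfl⟩
    obtain ⟨Θ, hΘ, hle₁, hle₂⟩ := hΓ.exists_upper hΔ₁ hΔ₂ h₁ h₂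
    exact ⟨trace _ hΘ (hΓ.trans h₁ hle₁), trace_le_trace _ hΔ₁ h₁ hΘ _ hle₁,
      trace_le_trace _ hΔ₂ h₂ hΘ _ hle₂⟩

/-- A finite rooted directed preorder is a bounded morphic image of the power set of its
points, ordered by inclusion and with every point blown up to a cluster indexed by the points. -/
theorem exists_state_map (W : Type) [Preorder W] [Finite W] (r : W) (hr : ∀ w, r ≤ w)
    (hdir : ∀ a b : W, ∃ c, a ≤ c ∧ b ≤ c) :
    ∃ st : Set W → W → W, st ∅ r = r ∧ (∀ P P' d d', P ⊆ P' → st P d ≤ st P' d') ∧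
      ∀ P d u, st P d ≤ u → ∃ P' d', P ⊆ P' ∧ st P' d' = u := by
  classical
  have : Nonempty W := ⟨r⟩
  obtain ⟨t, ht⟩ : ∃ t : W, ∀ w, w ≤ t :=
    Directed.finite_le (r := (· ≤ ·)) (f := id) (fun a b => hdir a b) id
  have hgr : ∀ P : Set W, (∀ x ∈ P, ∀ y ∈ P, x ≤ y ∨ y ≤ x) →
      ∃ g, (g ∈ P ∨ g = r) ∧ ∀ x ∈ P, x ≤ g := by
    intro P hP
    rcases P.eq_empty_or_nonempty with rfl | ⟨p, hp⟩
    · exact ⟨r, Or.inr rfl, fun x hx => hx.elim⟩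
    · have : Nonempty P := ⟨⟨p, hp⟩⟩
      obtain ⟨g, hg⟩ := Directed.finite_le (r := (· ≤ ·)) (f := ((↑) : P → W))
        (fun a b => (hP a a.2 b b.2).elim (fun h => ⟨b, h, le_rfl⟩) fun h => ⟨a, le_rfl, h⟩) id
      exact ⟨g, Or.inl g.2, fun x hx => hg ⟨x, hx⟩⟩
  -- The cluster selected by `P`: that of a greatest element if `P` is a nonempty chain, that of the
  -- root if `P = ∅`, and the top one otherwise. Enlarging `P` can only move it up.
  let cl : Set W → W := fun P =>
    if h : ∀ x ∈ P, ∀ y ∈ P, x ≤ y ∨ y ≤ x then (hgr P h).choose else t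
  have hcl : ∀ P, (∀ x ∈ P, ∀ y ∈ P, x ≤ y ∨ y ≤ x) →
      (cl P ∈ P ∨ cl P = r) ∧ ∀ x ∈ P, x ≤ cl P := by
    intro P h
    simp only [cl, dif_pos h]
    exact (hgr P h).choose_spec
  have hcl' : ∀ P, (¬ ∀ x ∈ P, ∀ y ∈ P, x ≤ y ∨ y ≤ x) → cl P = t := by
    intro P h
    simp only [cl, dif_neg h]
  have hmono : ∀ P P', P ⊆ P' → cl P ≤ cl P' := by
    intro P P' hs
    by_cases h' : ∀ x ∈ P', ∀ y ∈ P', x ≤ y ∨ y ≤ x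
    · rcases (hcl P fun x hx y hy => h' x (hs hx) y (hs hy)).1 with h | h
      · exact (hcl P' h').2 _ (hs h)
      · rw [h]; exact hr _
    · rw [hcl' P' h']; exact ht _
  have hst : ∀ P d, (if cl P ≤ d ∧ d ≤ cl P then d else cl P) ≤ cl P ∧
      cl P ≤ (if cl P ≤ d ∧ d ≤ cl P then d else cl P) := by
    intro P d
    split_ifs with h
    · exact ⟨h.2, h.1⟩
    · exact ⟨le_rfl, le_rfl⟩
  -- The second coordinate chooses a point inside the selected cluster and is ignored when it lies
  -- outside.
  refine ⟨fun P d => if cl P ≤ d ∧ d ≤ cl P then d else cl P, ?_, ?_, ?_⟩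
  · have : cl ∅ = r := by simpa using (hcl ∅ (by simp)).1
    simp [this]
  · intro P P' d d' hs
    exact (hst P d).1.trans ((hmono P P' hs).trans (hst P' d').2)
  · intro P d u hu
    have hu' : cl P ≤ u := (hst P d).2.trans hu
    by_cases h : ∀ x ∈ P, ∀ y ∈ P, x ≤ y ∨ y ≤ x
    -- Adding `u` to the chain keeps it a chain and makes `u` a greatest element.
    · have hle : ∀ x ∈ insert u P, x ≤ u := by
        rintro x (rfl | hx)
        · exact le_rfl
        · exact ((hcl P h).2 x hx).trans hu'
      have h2 : ∀ x ∈ insert u P, ∀ y ∈ insert u P, x ≤ y ∨ y ≤ x := by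
        rintro x hx y (rfl | hy)
        · exact Or.inl (hle x hx)
        · rcases hx with rfl | hx
          · exact Or.inr (hle y (Or.inr hy))
          · exact h x hx y hy
      refine ⟨insert u P, u, Set.subset_insert _ _, if_pos ⟨?_, (hcl _ h2).2 u (Or.inl rfl)⟩⟩
      rcases (hcl _ h2).1 with h3 | h3
      · exact hle _ h3
      · rw [h3]; exact hr _
    -- For a non-chain the top cluster is already selected and contains `u`, so only the second
    -- coordinate changes.
    · refine ⟨P, u, subset_rfl, if_pos ⟨hu', ?_⟩⟩
      rw [hcl' P h]
      exact ht u

/-- Any Boolean combination of finitely many pure sentences is expressed by a pure sentence. -/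
theorem exists_pure_boolean {V : Type u} [setLang.Structure V] (δ : V) {A : Type u} (v : A → V)
    (m : ℕ) (b : Fin m → PotFormula A 0) (hb : ∀ i, (b i).IsPureZF)
    (g : (Fin m → Prop) → Prop) :
    ∃ ψ : PotFormula A 0, ψ.IsPureZF ∧
      ∀ N, ψ.Holds δ v N Fin.elim0 ↔ g fun i => (b i).Holds δ v N Fin.elim0 := by
  classical
  induction m with
  | zero =>
    by_cases h : g Fin.elim0
    · exact ⟨.imp .falsum .falsum, ⟨trivial, trivial⟩, fun N => by
        rw [Subsingleton.elim (fun i => (b i).Holds δ v N Fin.elim0) Fin.elim0]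
        simpa [PotFormula.Holds] using h⟩
    · exact ⟨.falsum, trivial, fun N => by
        rw [Subsingleton.elim (fun i => (b i).Holds δ v N Fin.elim0) Fin.elim0]
        simpa [PotFormula.Holds] using h⟩
  | succ m ih =>
    obtain ⟨ψ₁, p₁, h₁⟩ := ih (fun i => b i.succ) (fun i => hb _) fun p => g (Fin.cons True p)
    obtain ⟨ψ₂, p₂, h₂⟩ := ih (fun i => b i.succ) (fun i => hb _) fun p => g (Fin.cons False p)
    -- Shannon expansion in the first argument: `(b₀ → ψ₁) ∧ (¬b₀ → ψ₂)`, written with `→` and `⊥`.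
    refine ⟨.imp (.imp (.imp (b 0) ψ₁) (.imp (.imp (.imp (b 0) .falsum) ψ₂) .falsum)) .falsum,
      ⟨⟨⟨hb 0, p₁⟩, ⟨⟨⟨hb 0, trivial⟩, p₂⟩, trivial⟩⟩, trivial⟩, fun N => ?_⟩
    have hc : (fun i => (b i).Holds δ v N Fin.elim0) =
        Fin.cons ((b 0).Holds δ v N Fin.elim0) (fun i => (b i.succ).Holds δ v N Fin.elim0) :=
      (Fin.cons_self_tail _).symm
    simp only [PotFormula.Holds, h₁, h₂, hc]
    by_cases h0 : (b 0).Holds δ v N Fin.elim0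
    · simp [h0]
    · simp [h0]

/-! ### Definability over `V` -/

section Definability

variable {V : Type u} [setLang.Structure V]

/-- The membership symbol. -/
def memSymbol : setLang.Relations 2 := SetRel.mem

/-- `P` is first-order definable over `V` with parameters. -/
class DefinablePred {n : ℕ} (P : (Fin n → V) → Prop) : Prop where
  out : ∃ φ : (setLang[[(Set.univ : Set V)]]).BoundedFormula Empty n,
    ∀ e, φ.Realize default e ↔ P e

/-- `t` is a variable or a parameter. -/
class SimpleTerm {n : ℕ} (t : (Fin n → V) → V) : Prop where
  out : ∃ τ : (setLang[[(Set.univ : Set V)]]).Term (Empty ⊕ Fin n),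
    ∀ e, τ.realize (Sum.elim default e) = t e

open FirstOrder.Language

instance SimpleTerm.var {n : ℕ} (k : Fin n) : SimpleTerm fun e : Fin n → V => e k :=
  ⟨Term.var (Sum.inr k), fun _ => rfl⟩

instance SimpleTerm.const {n : ℕ} (c : V) : SimpleTerm fun _ : Fin n → V => c :=
  ⟨(setLang.con (⟨c, trivial⟩ : (Set.univ : Set V))).term, fun e => by simp⟩

/-- Under a quantifier the earlier variables reappear as `e k.castSucc`; this instance absorbs such
reindexings, so that instance search can prove definability. -/
instance SimpleTerm.comp {m n : ℕ} {t : (Fin n → V) → V} [ht : SimpleTerm t]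
    (ρ : Fin n → Fin m) : SimpleTerm fun e : Fin m → V => t fun k => e (ρ k) := by
  obtain ⟨τ, hτ⟩ := ht.out
  refine ⟨τ.relabel (Sum.map id ρ), fun e => ?_⟩
  rw [Term.realize_relabel, ← hτ]
  congr 1
  funext x
  rcases x with x | x
  · exact x.elim
  · rfl

namespace DefinablePred

variable {n : ℕ} {P Q : (Fin n → V) → Prop} {s t : (Fin n → V) → V}

instance mem [hs : SimpleTerm s] [ht : SimpleTerm t] : DefinablePred fun e => s e ∈ᵥ t e := by
  obtain ⟨σ, hσ⟩ := hs.out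
  obtain ⟨τ, hτ⟩ := ht.out
  refine ⟨Relations.boundedFormula₂
    ((setLang.lhomWithConstants (Set.univ : Set V)).onRelation memSymbol) σ τ, fun e => ?_⟩
  rw [BoundedFormula.realize_rel₂, ← hσ, ← hτ, LHom.map_onRelation]
  rfl

instance eq [hs : SimpleTerm s] [ht : SimpleTerm t] : DefinablePred fun e => s e = t e := by
  obtain ⟨σ, hσ⟩ := hs.out
  obtain ⟨τ, hτ⟩ := ht.out
  exact ⟨Term.bdEqual σ τ, fun e => by rw [BoundedFormula.realize_bdEqual, hσ, hτ]⟩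

instance false : DefinablePred fun _ : Fin n → V => False :=
  ⟨⊥, fun _ => by simp⟩

instance imp [hP : DefinablePred P] [hQ : DefinablePred Q] :
    DefinablePred fun e => P e → Q e := by
  obtain ⟨φ, hφ⟩ := hP.out
  obtain ⟨ψ, hψ⟩ := hQ.out
  exact ⟨φ.imp ψ, fun e => by rw [BoundedFormula.realize_imp, hφ, hψ]⟩

instance all {P : (Fin n → V) → V → Prop}
    [hP : DefinablePred fun e : Fin (n + 1) → V => P (fun k => e k.castSucc) (e (Fin.last n))] :
    DefinablePred fun e => ∀ y, P e y := by
  obtain ⟨φ, hφ⟩ := hP.out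
  exact ⟨φ.all, fun e => by simp [BoundedFormula.realize_all, hφ]⟩

theorem congr (hP : DefinablePred P) (h : ∀ e, Q e ↔ P e) : DefinablePred Q :=
  ⟨hP.out.imp fun _ hφ e => (hφ e).trans (h e).symm⟩

instance not [DefinablePred P] : DefinablePred fun e => ¬ P e :=
  inferInstanceAs (DefinablePred fun e => P e → False)

instance ne [SimpleTerm s] [SimpleTerm t] : DefinablePred fun e => s e ≠ t e :=
  inferInstanceAs (DefinablePred fun e => ¬ s e = t e)

instance and [DefinablePred P] [DefinablePred Q] : DefinablePred fun e => P e ∧ Q e :=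
  congr (P := fun e => ¬ (P e → ¬ Q e)) inferInstance fun e => by tauto

instance or [DefinablePred P] [DefinablePred Q] : DefinablePred fun e => P e ∨ Q e :=
  congr (P := fun e => ¬ P e → Q e) inferInstance fun e => by tauto

instance iff [DefinablePred P] [DefinablePred Q] : DefinablePred fun e => P e ↔ Q e :=
  congr (P := fun e => (P e → Q e) ∧ (Q e → P e)) inferInstance fun e => by tauto

instance ex {P : (Fin n → V) → V → Prop}
    [DefinablePred fun e : Fin (n + 1) → V => P (fun k => e k.castSucc) (e (Fin.last n))] :
    DefinablePred fun e => ∃ y, P e y :=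
  congr (P := fun e => ¬ ∀ y, ¬ P e y) inferInstance fun e => by simp

/-- Unfolding `∃!` puts `P` under one quantifier and also under two, hence the two hypotheses. -/
instance exUnique {P : (Fin n → V) → V → Prop}
    [DefinablePred fun e : Fin (n + 1) → V => P (fun k => e k.castSucc) (e (Fin.last n))]
    [DefinablePred fun e : Fin (n + 2) → V =>
      P (fun k => e k.castSucc.castSucc) (e (Fin.last (n + 1)))] :
    DefinablePred fun e => ∃! y, P e y :=
  congr (P := fun e => ∃ y, P e y ∧ ∀ z, P e z → z = y) inferInstance fun _ => Iff.rfl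

end DefinablePred

instance {n : ℕ} {s t : (Fin n → V) → V} [SimpleTerm s] [SimpleTerm t] :
    DefinablePred fun e => IsSucc (s e) (t e) := by unfold IsSucc; infer_instance

instance {n : ℕ} {t : (Fin n → V) → V} [SimpleTerm t] : DefinablePred fun e => IsEmptySet (t e) := by
  unfold IsEmptySet; infer_instance

instance {n : ℕ} {t : (Fin n → V) → V} [SimpleTerm t] (k : ℕ) :
    DefinablePred fun e => IsNum k (t e) := by
  induction k generalizing n with
  | zero => unfold IsNum; infer_instance
  | succ k ih => unfold IsNum; infer_instance

section Notions

variable {n : ℕ} {r s t q : (Fin n → V) → V}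
  [SimpleTerm r] [SimpleTerm s] [SimpleTerm t] [SimpleTerm q]

instance : DefinablePred fun e => Sub (r e) (s e) := by unfold Sub; infer_instance
instance : DefinablePred fun e => IsUPair (r e) (s e) (t e) := by
  unfold IsUPair; infer_instance
instance : DefinablePred fun e => IsInductive (r e) := by unfold IsInductive; infer_instance
instance : DefinablePred fun e => IsOPair (r e) (s e) (t e) := by
  unfold IsOPair; infer_instance
instance : DefinablePred fun e => PairMem (r e) (s e) (t e) := by
  unfold PairMem; infer_instance
instance : DefinablePred fun e => IsFun (r e) (s e) (t e) := by unfold IsFun; infer_instance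
instance : DefinablePred fun e => IsTrans (r e) := by unfold IsTrans; infer_instance
instance : DefinablePred fun e => IsNat (r e) := by unfold IsNat; infer_instance
instance : DefinablePred fun e => IsOmega (r e) := by unfold IsOmega; infer_instance

instance (k : ℕ) : DefinablePred fun e => IsCode k (r e) (s e) (t e) := by
  unfold IsCode; infer_instance
instance : DefinablePred fun e => FormClosed (r e) := by unfold FormClosed; infer_instance
instance : DefinablePred fun e => IsForm (r e) := by unfold IsForm; infer_instance
instance : DefinablePred fun e => IsAsg (r e) (s e) := by unfold IsAsg; infer_instance
instance : DefinablePred fun e => AgreeOff (r e) (s e) (t e) := by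
  unfold AgreeOff; infer_instance

end Notions

end Definability

/-! ### Elementary set theory inside `V` -/

section Basics

variable {V : Type u} [setLang.Structure V]

theorem DefinablePred.definable {n : ℕ} (P : (Fin n → V) → Prop) [hP : DefinablePred P] :
    (Set.univ : Set V).Definable setLang {e | P e} := by
  obtain ⟨φ, hφ⟩ := hP.out
  refine ⟨φ.toFormula.relabel (Sum.elim Empty.elim id), ?_⟩
  ext e
  rw [Set.mem_ofPred_eq, Set.mem_ofPred_eq, FirstOrder.Language.Formula.realize_relabel,
    FirstOrder.Language.BoundedFormula.realize_toFormula, ← hφ]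
  exact iff_of_eq (congrArg₂ _ (Subsingleton.elim _ _) rfl)

variable [hV : Fact (IsModelZF V)]

theorem ext {x y : V} (h : ∀ z, z ∈ᵥ x ↔ z ∈ᵥ y) : x = y :=
  hV.out.extensionality x y h

theorem exists_sep (P : V → Prop)
    [DefinablePred fun e : Fin 1 → V => P (e 0)] (a : V) :
    ∃ b, ∀ z, z ∈ᵥ b ↔ z ∈ᵥ a ∧ P z :=
  hV.out.separation {x | P x} (DefinablePred.definable fun e : Fin 1 → V => P (e 0)) a

theorem exists_replace (R : V → V → Prop)
    [DefinablePred fun e : Fin 2 → V => R (e 0) (e 1)] (a : V)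
    (h : ∀ x, x ∈ᵥ a → ∃! y, R x y) : ∃ b, ∀ y, y ∈ᵥ b ↔ ∃ x, x ∈ᵥ a ∧ R x y :=
  hV.out.replacement {p | R p.1 p.2}
    (DefinablePred.definable fun e : Fin 2 → V => R (e 0) (e 1)) a h

/-- The unordered pair. -/
noncomputable def upair (a b : V) : V := (hV.out.pairing a b).choose

@[simp] theorem mem_upair {a b z : V} : z ∈ᵥ upair a b ↔ z = a ∨ z = b :=
  (hV.out.pairing a b).choose_spec z

@[simp] theorem isUPair_iff {p a b : V} : IsUPair p a b ↔ p = upair a b :=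
  ⟨fun h => ext fun z => by rw [h z, mem_upair], fun h z => by rw [h, mem_upair]⟩

theorem upair_eq_upair_left {a b c : V} (h : upair a b = upair a c) : b = c := by
  have h1 : b ∈ᵥ upair a c := h ▸ mem_upair.2 (Or.inr rfl)
  have h2 : c ∈ᵥ upair a b := h ▸ mem_upair.2 (Or.inr rfl)
  rcases mem_upair.1 h1 with rfl | h1
  · rcases mem_upair.1 h2 with h2 | h2 <;> exact h2.symm
  · exact h1

/-- The ordered pair. -/
noncomputable def opair (a b : V) : V := upair (upair a a) (upair a b)

@[simp] theorem isOPair_iff {p a b : V} : IsOPair p a b ↔ p = opair a b := by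
  simp [IsOPair, opair]

@[simp] theorem pairMem_iff {r a b : V} : PairMem r a b ↔ opair a b ∈ᵥ r := by
  simp [PairMem]

@[simp] theorem opair_inj {a b c d : V} : opair a b = opair c d ↔ a = c ∧ b = d := by
  refine ⟨fun h => ?_, by rintro ⟨rfl, rfl⟩; rfl⟩
  have hac : a = c := by
    have : upair a a ∈ᵥ opair c d := h ▸ mem_upair.2 (Or.inl rfl)
    have hc : c ∈ᵥ upair a a := by
      rcases mem_upair.1 this with h | h <;> rw [h] <;> simp
    simpa [eq_comm] using mem_upair.1 hc
  subst hac
  exact ⟨rfl, upair_eq_upair_left (upair_eq_upair_left h)⟩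

theorem exists_sUnion (a : V) : ∃ b, ∀ z, z ∈ᵥ b ↔ ∃ y, y ∈ᵥ a ∧ z ∈ᵥ y := hV.out.union a

/-- The union of two sets. -/
noncomputable def union (a b : V) : V := (exists_sUnion (upair a b)).choose

@[simp] theorem mem_union {a b z : V} : z ∈ᵥ union a b ↔ z ∈ᵥ a ∨ z ∈ᵥ b := by
  rw [union, (exists_sUnion (upair a b)).choose_spec z]
  simp

/-- The power set. -/
noncomputable def pow (a : V) : V := (hV.out.powerset a).choose

@[simp] theorem mem_pow {a z : V} : z ∈ᵥ pow a ↔ Sub z a :=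
  (hV.out.powerset a).choose_spec z

theorem exists_empty : ∃ x : V, IsEmptySet x :=
  let ⟨_, ⟨x, hx, _⟩, _⟩ := hV.out.infinity
  ⟨x, hx⟩

variable (V) in
/-- The empty set. -/
noncomputable def emp : V := exists_empty.choose

@[simp] theorem not_mem_emp {z : V} : ¬ z ∈ᵥ emp V := exists_empty.choose_spec z

@[simp] theorem isEmptySet_iff {x : V} : IsEmptySet x ↔ x = emp V :=
  ⟨fun h => ext fun z => by simp [h z], fun h z => by simp [h]⟩

/-- The successor. -/
noncomputable def suc (a : V) : V := union a (upair a a)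

@[simp] theorem mem_suc {a z : V} : z ∈ᵥ suc a ↔ z ∈ᵥ a ∨ z = a := by simp [suc]

@[simp] theorem isSucc_iff {s a : V} : IsSucc s a ↔ s = suc a :=
  ⟨fun h => ext fun z => by rw [h z, mem_suc], fun h z => by rw [h, mem_suc]⟩

theorem not_mem_self (x : V) : ¬ x ∈ᵥ x := by
  intro h
  obtain ⟨y, hy, h'⟩ := hV.out.foundation (upair x x) ⟨x, by simp⟩
  obtain rfl : y = x := by simpa using hy
  exact h' y h (by simp)

theorem not_mem_mem {x y : V} (h : x ∈ᵥ y) : ¬ y ∈ᵥ x := by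
  intro h₂
  obtain ⟨z, hz, h'⟩ := hV.out.foundation (upair x y) ⟨x, by simp⟩
  rcases mem_upair.1 hz with rfl | rfl
  · exact h' y h₂ (by simp)
  · exact h' x h (by simp)

theorem suc_ne_emp {x : V} : suc x ≠ emp V := fun h =>
  not_mem_emp (h ▸ mem_suc.2 (Or.inr rfl) : x ∈ᵥ emp V)

@[simp] theorem suc_inj {x y : V} : suc x = suc y ↔ x = y := by
  refine ⟨fun h => ?_, fun h => h ▸ rfl⟩
  have h1 : x ∈ᵥ suc y := h ▸ mem_suc.2 (Or.inr rfl)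
  have h2 : y ∈ᵥ suc x := h ▸ mem_suc.2 (Or.inr rfl)
  rcases mem_suc.1 h1 with h1 | h1
  · rcases mem_suc.1 h2 with h2 | h2
    · exact (not_mem_mem h1 h2).elim
    · exact h2.symm
  · exact h1

theorem isNat_emp : IsNat (emp V) := fun _ hu => hu.1 _ (isEmptySet_iff.2 rfl)

theorem isNat_suc {n : V} (h : IsNat n) : IsNat (suc n) := fun u hu =>
  hu.2 n _ (h u hu) (isSucc_iff.2 rfl)

theorem exists_isOmega : ∃ w : V, IsOmega w := by
  obtain ⟨u, ⟨x, hx, hxu⟩, h⟩ := hV.out.infinity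
  obtain ⟨w, hw⟩ := exists_sep IsNat u
  refine ⟨w, fun n => ⟨fun hn => ((hw n).1 hn).2, fun hn => (hw n).2 ⟨hn u ⟨?_, ?_⟩, hn⟩⟩⟩
  · rintro y hy
    rw [isEmptySet_iff] at hx hy
    rwa [hy, ← hx]
  · intro y s hy hs
    obtain ⟨s', hs', hm⟩ := h y hy
    rw [isSucc_iff] at hs hs'
    rwa [hs, ← hs']

variable (V) in
/-- The set of natural numbers. -/
noncomputable def omg : V := exists_isOmega.choose

@[simp] theorem mem_omg {n : V} : n ∈ᵥ omg V ↔ IsNat n := exists_isOmega.choose_spec n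

@[simp] theorem isOmega_iff {w : V} : IsOmega w ↔ w = omg V :=
  ⟨fun h => ext fun z => by rw [h z, mem_omg], fun h z => by rw [h, mem_omg]⟩

/-- `omg V` may have nonstandard elements, so induction is restricted to definable properties, for
which separation yields an inductive set. -/
theorem nat_induction (P : V → Prop) [DefinablePred fun e : Fin 1 → V => P (e 0)]
    (h0 : P (emp V)) (hs : ∀ n, IsNat n → P n → P (suc n)) {n : V} (hn : IsNat n) : P n := by
  obtain ⟨w, hw⟩ := exists_sep P (omg V)
  have : IsInductive w := by
    refine ⟨fun x hx => ?_, fun x s hx h => ?_⟩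
    · rw [isEmptySet_iff.1 hx]
      exact (hw _).2 ⟨mem_omg.2 isNat_emp, h0⟩
    · rw [isSucc_iff.1 h]
      have := (hw _).1 hx
      exact (hw _).2 ⟨mem_omg.2 (isNat_suc (mem_omg.1 this.1)), hs _ (mem_omg.1 this.1) this.2⟩
  exact ((hw n).1 (hn w this)).2

theorem isNat_isTrans {n : V} (hn : IsNat n) : IsTrans n :=
  nat_induction IsTrans (fun _ h => (not_mem_emp h).elim) (fun n _ ih y hy z hz => by
    rcases mem_suc.1 hy with hy | rfl
    · exact mem_suc.2 (Or.inl (ih y hy z hz))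
    · exact mem_suc.2 (Or.inl hz)) hn

theorem isTrans_omg : IsTrans (omg V) := fun n hn => by
  refine nat_induction (fun n => Sub n (omg V)) (fun _ h => (not_mem_emp h).elim)
    (fun n hn ih y hy => ?_) (mem_omg.1 hn)
  rcases mem_suc.1 hy with hy | rfl
  · exact ih y hy
  · exact mem_omg.2 hn

variable (V) in
/-- The numerals. -/
noncomputable def num : ℕ → V
  | 0 => emp V
  | k + 1 => suc (num k)

@[simp] theorem isNum_iff {k : ℕ} {x : V} : IsNum k x ↔ x = num V k := by
  induction k generalizing x with
  | zero => simp [IsNum, num]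
  | succ k ih => simp [IsNum, num, ih]

@[simp] theorem isNat_num (k : ℕ) : IsNat (num V k) := by
  induction k with
  | zero => exact isNat_emp
  | succ k ih => exact isNat_suc ih

@[simp] theorem num_inj {k l : ℕ} : num V k = num V l ↔ k = l := by
  refine ⟨fun h => ?_, fun h => h ▸ rfl⟩
  induction k generalizing l with
  | zero =>
    cases l with
    | zero => rfl
    | succ l => exact (suc_ne_emp h.symm).elim
  | succ k ih =>
    cases l with
    | zero => exact (suc_ne_emp h).elim
    | succ l => rw [ih (suc_inj.1 h)]

/-- The code `(k, (a, b))`. -/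
noncomputable def code (k : ℕ) (a b : V) : V := opair (num V k) (opair a b)

@[simp] theorem isCode_iff {k : ℕ} {a b c : V} : IsCode k a b c ↔ c = code k a b := by
  simp [IsCode, code]

@[simp] theorem code_inj {k l : ℕ} {a b c d : V} :
    code k a b = code l c d ↔ k = l ∧ a = c ∧ b = d := by
  simp [code]

omit hV in
@[simp] theorem sub_refl (x : V) : Sub x x := fun _ h => h

omit hV in
theorem Sub.trans {x y z : V} (h₁ : Sub x y) (h₂ : Sub y z) : Sub x z :=
  fun w hw => h₂ w (h₁ w hw)

theorem isTrans_pow {x : V} (h : IsTrans x) : IsTrans (pow x) := fun _ hy z hz =>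
  mem_pow.2 (h z (mem_pow.1 hy z hz))

theorem sub_pow {x : V} (h : IsTrans x) : Sub x (pow x) := fun y hy => mem_pow.2 (h y hy)

theorem pow_mono {x y : V} (h : Sub x y) : Sub (pow x) (pow y) := fun _ hz =>
  mem_pow.2 ((mem_pow.1 hz).trans h)

theorem isTrans_union {x y : V} (hx : IsTrans x) (hy : IsTrans y) : IsTrans (union x y) :=
  fun z hz w hw => by
    rcases mem_union.1 hz with h | h
    · exact mem_union.2 (Or.inl (hx z h w hw))
    · exact mem_union.2 (Or.inr (hy z h w hw))

theorem isTrans_suc {x : V} (hx : IsTrans x) : IsTrans (suc x) := fun y hy z hz => by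
  rcases mem_suc.1 hy with hy | rfl
  · exact mem_suc.2 (Or.inl (hx y hy z hz))
  · exact mem_suc.2 (Or.inl hz)

theorem opair_mem_pow {a b v : V} (ha : a ∈ᵥ v) (hb : b ∈ᵥ v) :
    opair a b ∈ᵥ pow (pow v) := by
  rw [opair, mem_pow]
  intro z hz
  rw [mem_pow]
  intro y hy
  rcases mem_upair.1 hz with rfl | rfl <;> rcases mem_upair.1 hy with rfl | rfl <;> assumption

theorem mem_of_opair_mem {a b T : V} (hT : IsTrans T) (h : opair a b ∈ᵥ T) :
    a ∈ᵥ T ∧ b ∈ᵥ T :=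
  have h₁ : upair a b ∈ᵥ T := hT _ h _ (mem_upair.2 (Or.inr rfl))
  ⟨hT _ h₁ _ (mem_upair.2 (Or.inl rfl)), hT _ h₁ _ (mem_upair.2 (Or.inr rfl))⟩

/-! ### Recursion -/

/-- The set `f` of pairs is justified by the rule `J`. -/
def Justified (J : V → V → V → Prop) (f : V) : Prop := ∀ c s, opair c s ∈ᵥ f → J f c s

/-- The relation generated by the rule `J`. -/
def Generated (J : V → V → V → Prop) (c s : V) : Prop :=
  ∃ f, Justified J f ∧ opair c s ∈ᵥ f

/-- The rule `J` is monotone. -/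
def MonotoneRule (J : V → V → V → Prop) : Prop := ∀ f g c s, Sub f g → J f c s → J g c s

/-- Recursion is run through sets of pairs in which every pair is justified by the others. Such sets
need not be functions; in both applications a rule refers only to predecessors or subformulas, so
induction shows that each argument receives exactly one value. -/
theorem Generated.inv {J : V → V → V → Prop} {c s : V} (h : Generated J c s) :
    ∃ f, J f c s ∧ ∀ c' s', opair c' s' ∈ᵥ f → Generated J c' s' :=
  let ⟨f, hf, hm⟩ := h
  ⟨f, hf _ _ hm, fun _ _ h => ⟨f, hf, h⟩⟩

theorem Generated.intro {J : V → V → V → Prop} (hJ : MonotoneRule J) {f c s : V}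
    (hf : Justified J f) (h : J f c s) : Generated J c s := by
  refine ⟨union f (upair (opair c s) (opair c s)), fun c' s' h' => ?_, by simp⟩
  have hs : Sub f (union f (upair (opair c s) (opair c s))) :=
    fun z hz => mem_union.2 (Or.inl hz)
  rcases mem_union.1 h' with h' | h'
  · exact hJ _ _ _ _ hs (hf _ _ h')
  · simp only [mem_upair, opair_inj, or_self] at h'
    rw [h'.1, h'.2]
    exact hJ _ _ _ _ hs h

theorem Justified.union {J : V → V → V → Prop} (hJ : MonotoneRule J) {f g : V}
    (hf : Justified J f) (hg : Justified J g) : Justified J (union f g) := fun c s h => by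
  rcases mem_union.1 h with h | h
  · exact hJ _ _ _ _ (fun z hz => mem_union.2 (Or.inl hz)) (hf c s h)
  · exact hJ _ _ _ _ (fun z hz => mem_union.2 (Or.inr hz)) (hg c s h)

/-- `y = P^k(u)` follows from the values in `f`. -/
def PowRule (u f k y : V) : Prop :=
  (IsEmptySet k ∧ y = u) ∨
    ∃ k' y', IsSucc k k' ∧ (∀ z, z ∈ᵥ y ↔ Sub z y') ∧ PairMem f k' y'

instance {n : ℕ} {r s t q : (Fin n → V) → V} [SimpleTerm r] [SimpleTerm s] [SimpleTerm t]
    [SimpleTerm q] : DefinablePred fun e => PowRule (r e) (s e) (t e) (q e) := by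
  unfold PowRule; infer_instance

theorem monotone_powRule (u : V) : MonotoneRule (PowRule u) := by
  rintro f g c s h (h' | ⟨k, y, h₁, h₂, h₃⟩)
  · exact Or.inl h'
  · exact Or.inr ⟨k, y, h₁, h₂, pairMem_iff.2 (h _ (pairMem_iff.1 h₃))⟩

instance Generated.definable {n : ℕ} {J : V → V → V → Prop}
    {s t : (Fin n → V) → V} [SimpleTerm s] [SimpleTerm t]
    [DefinablePred fun e : Fin (n + 3) → V => J (e (Fin.last n).castSucc.castSucc)
      (e (Fin.last (n + 1)).castSucc) (e (Fin.last (n + 2)))] :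
    DefinablePred fun e => Generated J (s e) (t e) := by
  unfold Generated Justified
  simp only [← pairMem_iff]
  infer_instance

/-- The set of all iterated power sets of `u`, indexed by the internal `ω`, obtained by recursion
and replacement. The last clause is induction along the tower. -/
theorem exists_tower (u : V) :
    ∃ C : V, u ∈ᵥ C ∧ (∀ y, y ∈ᵥ C → pow y ∈ᵥ C) ∧
      ∀ D, u ∈ᵥ D → (∀ y, y ∈ᵥ C → y ∈ᵥ D → pow y ∈ᵥ D) → Sub C D := by
  have hex : ∀ {n : V}, IsNat n → ∃! y, Generated (PowRule u) n y := by
    intro n hn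
    refine nat_induction (fun n => ∃! y, Generated (PowRule u) n y) ?_ ?_ hn
    · refine ⟨u, .intro (monotone_powRule u) (f := emp V) (fun _ _ h => (not_mem_emp h).elim)
        (Or.inl ⟨isEmptySet_iff.2 rfl, rfl⟩), fun y hy => ?_⟩
      obtain ⟨f, h | ⟨k, _, h, _⟩, -⟩ := hy.inv
      · exact h.2
      · exact (suc_ne_emp (isSucc_iff.1 h).symm).elim
    · rintro n hn ⟨y, ⟨f, hf, hy⟩, huniq⟩
      refine ⟨pow y, .intro (monotone_powRule u) hf
        (Or.inr ⟨n, y, isSucc_iff.2 rfl, fun z => mem_pow, pairMem_iff.2 hy⟩), fun x hx => ?_⟩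
      obtain ⟨g, h | ⟨k, y', h, hp, hm⟩, hg⟩ := hx.inv
      · exact (suc_ne_emp (isEmptySet_iff.1 h.1)).elim
      · obtain rfl := suc_inj.1 (isSucc_iff.1 h)
        rw [huniq y' (hg _ _ (pairMem_iff.1 hm))] at hp
        exact ext fun z => by rw [hp, mem_pow]
  obtain ⟨C, hC⟩ := exists_replace (Generated (PowRule u)) (omg V) fun n hn => hex (mem_omg.1 hn)
  refine ⟨C, (hC u).2 ⟨emp V, mem_omg.2 isNat_emp, ?_⟩, fun y hy => ?_, fun D h0 hs => ?_⟩
  · exact .intro (monotone_powRule u) (f := emp V) (fun _ _ h => (not_mem_emp h).elim)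
        (Or.inl ⟨isEmptySet_iff.2 rfl, rfl⟩)
  · obtain ⟨n, hn, f, hf, hy⟩ := (hC y).1 hy
    exact (hC _).2 ⟨suc n, mem_omg.2 (isNat_suc (mem_omg.1 hn)), .intro (monotone_powRule u) hf
        (Or.inr ⟨n, y, isSucc_iff.2 rfl, fun z => mem_pow, pairMem_iff.2 hy⟩)⟩
  · intro y hy
    obtain ⟨n, hn, hy⟩ := (hC y).1 hy
    refine nat_induction (fun n => ∀ y, Generated (PowRule u) n y → y ∈ᵥ D) ?_ ?_ (mem_omg.1 hn)
      y hy
    · intro y hy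
      obtain ⟨f, h | ⟨k, _, h, _⟩, -⟩ := hy.inv
      · exact h.2 ▸ h0
      · exact (suc_ne_emp (isSucc_iff.1 h).symm).elim
    · intro n hn ih y hy
      obtain ⟨g, h | ⟨k, y', h, hp, hm⟩, hg⟩ := hy.inv
      · exact (suc_ne_emp (isEmptySet_iff.1 h.1)).elim
      · obtain rfl := suc_inj.1 (isSucc_iff.1 h)
        have hy' := hg _ _ (pairMem_iff.1 hm)
        obtain rfl : y = pow y' := ext fun z => by rw [hp, mem_pow]
        exact hs y' ((hC _).2 ⟨n, mem_omg.2 hn, hy'⟩) (ih _ hy')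

theorem tower_induction {u C : V} (hC : ∀ D, u ∈ᵥ D → (∀ y, y ∈ᵥ C → y ∈ᵥ D → pow y ∈ᵥ D) →
    Sub C D) (hu : u ∈ᵥ C) (hs : ∀ y, y ∈ᵥ C → pow y ∈ᵥ C) (P : V → Prop)
    [DefinablePred fun e : Fin 1 → V => P (e 0)] (h0 : P u)
    (h : ∀ y, y ∈ᵥ C → P y → P (pow y)) {y : V} (hy : y ∈ᵥ C) : P y := by
  obtain ⟨D, hD⟩ := exists_sep P C
  exact ((hD y).1 (hC D ((hD u).2 ⟨hu, h0⟩)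
    (fun z hz hzD => (hD _).2 ⟨hs z hz, h z hz ((hD z).1 hzD).2⟩) y hy)).2

/-- Transitive sets closed under subsets and under the operations of elementary set theory. -/
structure IsUniverse (B : V) : Prop where
  trans : IsTrans B
  sub {x y : V} : x ∈ᵥ B → Sub y x → y ∈ᵥ B
  pow {x : V} : x ∈ᵥ B → pow x ∈ᵥ B
  upair {x y : V} : x ∈ᵥ B → y ∈ᵥ B → upair x y ∈ᵥ B
  union {x y : V} : x ∈ᵥ B → y ∈ᵥ B → union x y ∈ᵥ B

/-- The union of the tower over `u`. As `u` is transitive the levels are directed under inclusion,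
so finitely many elements share a level and each operation lands at most one power set higher. -/
theorem exists_isUniverse {u : V} (hu : IsTrans u) : ∃ B, IsUniverse B ∧ u ∈ᵥ B := by
  obtain ⟨C, huC, hs, hmin⟩ := exists_tower u
  obtain ⟨B, hB⟩ := exists_sUnion C
  have htr : ∀ y, y ∈ᵥ C → IsTrans y := fun y hy =>
    tower_induction hmin huC hs IsTrans hu (fun y _ h => isTrans_pow h) hy
  have hsub : ∀ y, y ∈ᵥ C → Sub u y := fun y hy =>
    tower_induction hmin huC hs (fun y => Sub u y) (sub_refl u)
      (fun y hy h => h.trans (sub_pow (htr y hy))) hy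
  have hdir : ∀ y, y ∈ᵥ C → ∀ z, z ∈ᵥ C → ∃ w, w ∈ᵥ C ∧ Sub y w ∧ Sub z w := fun y hy =>
    tower_induction hmin huC hs (fun y => ∀ z, z ∈ᵥ C → ∃ w, w ∈ᵥ C ∧ Sub y w ∧ Sub z w)
      (fun z hz => ⟨z, hz, hsub z hz, sub_refl z⟩)
      (fun y _ h z hz =>
        let ⟨w, hw, h₁, h₂⟩ := h z hz
        ⟨_, hs w hw, pow_mono h₁, h₂.trans (sub_pow (htr w hw))⟩) hy
  have hdir' : ∀ x y, x ∈ᵥ B → y ∈ᵥ B → ∃ w, w ∈ᵥ C ∧ x ∈ᵥ w ∧ y ∈ᵥ w := by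
    intro x y hx hy
    obtain ⟨a, ha, hxa⟩ := (hB x).1 hx
    obtain ⟨b, hb, hyb⟩ := (hB y).1 hy
    obtain ⟨w, hw, h₁, h₂⟩ := hdir a ha b hb
    exact ⟨w, hw, h₁ _ hxa, h₂ _ hyb⟩
  have hmem : ∀ {w x}, w ∈ᵥ C → Sub x w → x ∈ᵥ B := fun {w x} hw h =>
    (hB x).2 ⟨_, hs w hw, mem_pow.2 h⟩
  refine ⟨B, ⟨fun x hx y hy => ?_, fun {x y} hx h => ?_, fun {x} hx => ?_, fun {x y} hx hy => ?_,
    fun {x y} hx hy => ?_⟩, hmem huC (sub_refl u)⟩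
  · obtain ⟨w, hw, h⟩ := (hB x).1 hx
    exact (hB y).2 ⟨w, hw, htr w hw x h y hy⟩
  · obtain ⟨w, hw, hxw⟩ := (hB x).1 hx
    exact hmem hw (h.trans (htr w hw x hxw))
  · obtain ⟨w, hw, hxw⟩ := (hB x).1 hx
    exact hmem (hs w hw) (pow_mono (htr w hw x hxw))
  · obtain ⟨w, hw, h₁, h₂⟩ := hdir' x y hx hy
    refine hmem hw fun z hz => ?_
    rcases mem_upair.1 hz with rfl | rfl <;> assumption
  · obtain ⟨w, hw, h₁, h₂⟩ := hdir' x y hx hy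
    refine hmem hw fun z hz => ?_
    rcases mem_union.1 hz with h | h
    · exact htr w hw x h₁ z h
    · exact htr w hw y h₂ z h

theorem IsUniverse.opair {B x y : V} (hB : IsUniverse B) (hx : x ∈ᵥ B) (hy : y ∈ᵥ B) :
    opair x y ∈ᵥ B := hB.upair (hB.upair hx hx) (hB.upair hx hy)

/-- A universe containing `v` contains every relation on `v`. -/
theorem IsUniverse.relation {B v f : V} (hB : IsUniverse B) (hv : v ∈ᵥ B)
    (hf : ∀ p, p ∈ᵥ f → ∃ x y, x ∈ᵥ v ∧ y ∈ᵥ v ∧ p = Potentialism.opair x y) : f ∈ᵥ B :=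
  hB.sub (hB.pow (hB.pow hv)) fun p hp => by
    obtain ⟨x, y, hx, hy, rfl⟩ := hf p hp
    exact opair_mem_pow hx hy

/-- The set of pairs in `a × b` satisfying a definable relation. -/
theorem exists_sep_pairs (a b : V) (R : V → V → Prop)
    [DefinablePred fun e : Fin 3 → V => R (e (Fin.last 1).castSucc) (e (Fin.last 2))] :
    ∃ f, ∀ p, p ∈ᵥ f ↔ ∃ x y, x ∈ᵥ a ∧ y ∈ᵥ b ∧ p = opair x y ∧ R x y := by
  obtain ⟨f, hf⟩ := exists_sep
    (fun p => ∃ x y, x ∈ᵥ a ∧ y ∈ᵥ b ∧ IsOPair p x y ∧ R x y) (pow (pow (union a b)))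
  refine ⟨f, fun p => ?_⟩
  rw [hf]
  simp only [isOPair_iff]
  refine and_iff_right_of_imp ?_
  rintro ⟨x, y, hx, hy, rfl, -⟩
  exact opair_mem_pow (mem_union.2 (Or.inl hx)) (mem_union.2 (Or.inr hy))

/-! ### Formulas -/

theorem isForm_code_zero {i j : V} (hi : IsNat i) (hj : IsNat j) : IsForm (code 0 i j) :=
  fun _ hX => hX.1 i j _ hi hj (isCode_iff.2 rfl)

theorem isForm_code_one {i j : V} (hi : IsNat i) (hj : IsNat j) : IsForm (code 1 i j) :=
  fun _ hX => hX.2.1 i j _ hi hj (isCode_iff.2 rfl)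

theorem isForm_code_two {φ : V} (h : IsForm φ) : IsForm (code 2 φ φ) :=
  fun X hX => hX.2.2.1 φ _ (h X hX) (isCode_iff.2 rfl)

theorem isForm_code_three {φ ψ : V} (h : IsForm φ) (h' : IsForm ψ) : IsForm (code 3 φ ψ) :=
  fun X hX => hX.2.2.2.1 φ ψ _ (h X hX) (h' X hX) (isCode_iff.2 rfl)

theorem isForm_code_four {i φ : V} (hi : IsNat i) (h : IsForm φ) : IsForm (code 4 i φ) :=
  fun X hX => hX.2.2.2.2 i φ _ hi (h X hX) (isCode_iff.2 rfl)

theorem formClosed_of_opair {X : V} (hω : Sub (omg V) X)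
    (h : ∀ x y, x ∈ᵥ X → y ∈ᵥ X → opair x y ∈ᵥ X) : FormClosed X := by
  have hc : ∀ k a b, a ∈ᵥ X → b ∈ᵥ X → code k a b ∈ᵥ X := fun k a b ha hb =>
    h _ _ (hω _ (mem_omg.2 (isNat_num k))) (h _ _ ha hb)
  have hn : ∀ i, IsNat i → i ∈ᵥ X := fun i hi => hω _ (mem_omg.2 hi)
  simp only [FormClosed, isCode_iff]
  exact ⟨fun i j c hi hj hc' => hc' ▸ hc _ _ _ (hn i hi) (hn j hj),
    fun i j c hi hj hc' => hc' ▸ hc _ _ _ (hn i hi) (hn j hj),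
    fun φ c hφ hc' => hc' ▸ hc _ _ _ hφ hφ,
    fun φ ψ c hφ hψ hc' => hc' ▸ hc _ _ _ hφ hψ,
    fun i φ c hi hφ hc' => hc' ▸ hc _ _ _ (hn i hi) hφ⟩

variable (V) in
theorem exists_forms : ∃ F : V, ∀ φ, φ ∈ᵥ F ↔ IsForm φ := by
  obtain ⟨B, hB, hω⟩ := exists_isUniverse (isTrans_omg (V := V))
  obtain ⟨F, hF⟩ := exists_sep IsForm B
  exact ⟨F, fun φ => (hF φ).trans (and_iff_right_of_imp fun h =>
    h B (formClosed_of_opair (hB.trans _ hω) fun x y => hB.opair))⟩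

variable (V) in
/-- The set of formulas. -/
noncomputable def forms : V := (exists_forms V).choose

@[simp] theorem mem_forms {φ : V} : φ ∈ᵥ forms V ↔ IsForm φ := (exists_forms V).choose_spec φ

theorem form_induction (P : V → Prop) [DefinablePred fun e : Fin 1 → V => P (e 0)]
    (h0 : ∀ i j, IsNat i → IsNat j → P (code 0 i j))
    (h1 : ∀ i j, IsNat i → IsNat j → P (code 1 i j))
    (h2 : ∀ φ, IsForm φ → P φ → P (code 2 φ φ))
    (h3 : ∀ φ ψ, IsForm φ → IsForm ψ → P φ → P ψ → P (code 3 φ ψ))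
    (h4 : ∀ i φ, IsNat i → IsForm φ → P φ → P (code 4 i φ)) {φ : V} (hφ : IsForm φ) : P φ := by
  obtain ⟨X, hX⟩ := exists_sep P (forms V)
  simp only [mem_forms] at hX
  refine ((hX φ).1 (hφ X ?_)).2
  simp only [FormClosed, isCode_iff, hX]
  refine ⟨?_, ?_, ?_, ?_, ?_⟩
  · rintro i j _ hi hj rfl
    exact ⟨isForm_code_zero hi hj, h0 i j hi hj⟩
  · rintro i j _ hi hj rfl
    exact ⟨isForm_code_one hi hj, h1 i j hi hj⟩
  · rintro φ _ hφ rfl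
    exact ⟨isForm_code_two hφ.1, h2 φ hφ.1 hφ.2⟩
  · rintro φ ψ _ hφ hψ rfl
    exact ⟨isForm_code_three hφ.1 hψ.1, h3 φ ψ hφ.1 hψ.1 hφ.2 hψ.2⟩
  · rintro i φ _ hi hφ rfl
    exact ⟨isForm_code_four hi hφ.1, h4 i φ hi hφ.1 hφ.2⟩

end Basics

/-! ### Satisfaction -/

section Satisfaction

variable {V : Type u} [setLang.Structure V] [hV : Fact (IsModelZF V)]

theorem isAsg_iff {M a : V} : IsAsg M a ↔ IsFun a (omg V) M := by simp [IsAsg]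

omit hV in
theorem IsFun.unique {f a b x y z : V} (hf : IsFun f a b) (hx : x ∈ᵥ a) (hy : PairMem f x y)
    (hz : PairMem f x z) : y = z := (hf.2 x hx).unique hy hz

theorem IsFun.mem {f a b x y : V} (hf : IsFun f a b) (h : PairMem f x y) :
    x ∈ᵥ a ∧ y ∈ᵥ b := by
  obtain ⟨x', y', hx, hy, h'⟩ := hf.1 _ (pairMem_iff.1 h)
  simp only [isOPair_iff, opair_inj] at h'
  exact ⟨h'.1 ▸ hx, h'.2 ▸ hy⟩

variable (V) in
theorem exists_asgs (M : V) : ∃ A, ∀ a, a ∈ᵥ A ↔ IsAsg M a := by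
  obtain ⟨A, hA⟩ := exists_sep (IsAsg M) (pow (pow (pow (union (omg V) M))))
  refine ⟨A, fun a => (hA a).trans (and_iff_right_of_imp fun h => mem_pow.2 fun p hp => ?_)⟩
  obtain ⟨x, y, hx, hy, hp⟩ := (isAsg_iff.1 h).1 p hp
  rw [isOPair_iff.1 hp]
  exact opair_mem_pow (mem_union.2 (Or.inl hx)) (mem_union.2 (Or.inr hy))

/-- The set of assignments. -/
noncomputable def asgs (M : V) : V := (exists_asgs V M).choose

@[simp] theorem mem_asgs {M a : V} : a ∈ᵥ asgs M ↔ IsAsg M a := (exists_asgs V M).choose_spec a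

/-- The set `s` of assignments satisfying `c` is determined by Tarski's clauses from the values
in `f`. -/
def SatRule (M f c s : V) : Prop :=
  (∃ i j, IsNat i ∧ IsNat j ∧ IsCode 0 i j c ∧
    ∀ a, a ∈ᵥ s ↔ IsAsg M a ∧ ∃ x y, PairMem a i x ∧ PairMem a j y ∧ x ∈ᵥ y) ∨
  (∃ i j, IsNat i ∧ IsNat j ∧ IsCode 1 i j c ∧
    ∀ a, a ∈ᵥ s ↔ IsAsg M a ∧ ∃ x, PairMem a i x ∧ PairMem a j x) ∨
  (∃ φ t, IsCode 2 φ φ c ∧ PairMem f φ t ∧ ∀ a, a ∈ᵥ s ↔ IsAsg M a ∧ ¬ a ∈ᵥ t) ∨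
  (∃ φ ψ t r, IsCode 3 φ ψ c ∧ PairMem f φ t ∧ PairMem f ψ r ∧
    ∀ a, a ∈ᵥ s ↔ IsAsg M a ∧ a ∈ᵥ t ∧ a ∈ᵥ r) ∨
  ∃ i φ t, IsNat i ∧ IsCode 4 i φ c ∧ PairMem f φ t ∧
    ∀ a, a ∈ᵥ s ↔ IsAsg M a ∧ ∃ b, IsAsg M b ∧ AgreeOff i a b ∧ b ∈ᵥ t

set_option synthInstance.maxSize 1000 in
set_option synthInstance.maxHeartbeats 400000 in
instance {n : ℕ} {r s t q : (Fin n → V) → V} [SimpleTerm r] [SimpleTerm s] [SimpleTerm t]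
    [SimpleTerm q] : DefinablePred fun e => SatRule (r e) (s e) (t e) (q e) := by
  unfold SatRule; infer_instance

theorem monotone_satRule (M : V) : MonotoneRule (SatRule M) := by
  intro f g c s h
  have h' : ∀ x y, PairMem f x y → PairMem g x y := fun x y hp =>
    pairMem_iff.2 (h _ (pairMem_iff.1 hp))
  rintro (h₁ | h₁ | ⟨φ, t, h₁, h₂, h₃⟩ | ⟨φ, ψ, t, r, h₁, h₂, h₃, h₄⟩ | ⟨i, φ, t, h₀, h₁, h₂, h₃⟩)
  · exact Or.inl h₁
  · exact Or.inr (Or.inl h₁)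
  · exact Or.inr (Or.inr (Or.inl ⟨φ, t, h₁, h' _ _ h₂, h₃⟩))
  · exact Or.inr (Or.inr (Or.inr (Or.inl ⟨φ, ψ, t, r, h₁, h' _ _ h₂, h' _ _ h₃, h₄⟩)))
  · exact Or.inr (Or.inr (Or.inr (Or.inr ⟨i, φ, t, h₀, h₁, h' _ _ h₂, h₃⟩)))

theorem justified_emp {J : V → V → V → Prop} : Justified J (emp V) :=
  fun _ _ h => (not_mem_emp h).elim

theorem generated_code_zero {M i j s : V} (hi : IsNat i) (hj : IsNat j) :
    Generated (SatRule M) (code 0 i j) s ↔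
      ∀ a, a ∈ᵥ s ↔ IsAsg M a ∧ ∃ x y, PairMem a i x ∧ PairMem a j y ∧ x ∈ᵥ y := by
  constructor
  · intro h
    obtain ⟨f, h, -⟩ := h.inv
    simp only [SatRule, isCode_iff, code_inj] at h
    simp only [pairMem_iff] at h ⊢
    simpa [hi, hj] using h
  · exact fun h => .intro (monotone_satRule M) justified_emp
      (Or.inl ⟨i, j, hi, hj, isCode_iff.2 rfl, h⟩)

theorem generated_code_one {M i j s : V} (hi : IsNat i) (hj : IsNat j) :
    Generated (SatRule M) (code 1 i j) s ↔
      ∀ a, a ∈ᵥ s ↔ IsAsg M a ∧ ∃ x, PairMem a i x ∧ PairMem a j x := by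
  constructor
  · intro h
    obtain ⟨f, h, -⟩ := h.inv
    simp only [SatRule, isCode_iff, code_inj] at h
    simp only [pairMem_iff] at h ⊢
    simpa [hi, hj] using h
  · exact fun h => .intro (monotone_satRule M) justified_emp
      (Or.inr (Or.inl ⟨i, j, hi, hj, isCode_iff.2 rfl, h⟩))

/-- Uniqueness of the value at `φ` is assumed because a justified set could a priori use another
value; the induction in `existsUnique_generated` supplies it. The same applies to the next two
lemmas. -/
theorem generated_code_two {M φ s t : V} (ht : Generated (SatRule M) φ t)
    (hu : ∀ t', Generated (SatRule M) φ t' → t' = t) :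
    Generated (SatRule M) (code 2 φ φ) s ↔ ∀ a, a ∈ᵥ s ↔ IsAsg M a ∧ ¬ a ∈ᵥ t := by
  constructor
  · intro h
    obtain ⟨f, h, hf⟩ := h.inv
    simp only [SatRule, isCode_iff, code_inj, pairMem_iff] at h
    obtain ⟨φ, t', rfl, h₁, h₂⟩ : ∃ φ_1 t, φ = φ_1 ∧ opair φ_1 t ∈ᵥ f ∧
      ∀ a, a ∈ᵥ s ↔ IsAsg M a ∧ ¬ a ∈ᵥ t := by simpa using h
    rwa [← hu t' (hf _ _ h₁)]
  · obtain ⟨f, hf, hm⟩ := ht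
    exact fun h => .intro (monotone_satRule M) hf
      (Or.inr (Or.inr (Or.inl ⟨φ, t, isCode_iff.2 rfl, pairMem_iff.2 hm, h⟩)))

theorem generated_code_three {M φ ψ s t r : V} (ht : Generated (SatRule M) φ t)
    (hu : ∀ t', Generated (SatRule M) φ t' → t' = t) (hr : Generated (SatRule M) ψ r)
    (hur : ∀ t', Generated (SatRule M) ψ t' → t' = r) :
    Generated (SatRule M) (code 3 φ ψ) s ↔ ∀ a, a ∈ᵥ s ↔ IsAsg M a ∧ a ∈ᵥ t ∧ a ∈ᵥ r := by
  constructor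
  · intro h
    obtain ⟨f, h, hf⟩ := h.inv
    simp only [SatRule, isCode_iff, code_inj, pairMem_iff] at h
    obtain ⟨φ', ψ', t', r', ⟨rfl, rfl⟩, h₁, h₂, h₃⟩ : ∃ φ' ψ' t r, (φ = φ' ∧ ψ = ψ') ∧
      opair φ' t ∈ᵥ f ∧ opair ψ' r ∈ᵥ f ∧
      ∀ a, a ∈ᵥ s ↔ IsAsg M a ∧ a ∈ᵥ t ∧ a ∈ᵥ r := by simpa using h
    rwa [← hu t' (hf _ _ h₁), ← hur r' (hf _ _ h₂)]
  · obtain ⟨f, hf, hm⟩ := ht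
    obtain ⟨g, hg, hm'⟩ := hr
    exact fun h => .intro (monotone_satRule M) (hf.union (monotone_satRule M) hg)
      (Or.inr (Or.inr (Or.inr (Or.inl ⟨φ, ψ, t, r, isCode_iff.2 rfl,
        pairMem_iff.2 (mem_union.2 (Or.inl hm)), pairMem_iff.2 (mem_union.2 (Or.inr hm')), h⟩))))

theorem generated_code_four {M i φ s t : V} (hi : IsNat i) (ht : Generated (SatRule M) φ t)
    (hu : ∀ t', Generated (SatRule M) φ t' → t' = t) :
    Generated (SatRule M) (code 4 i φ) s ↔
      ∀ a, a ∈ᵥ s ↔ IsAsg M a ∧ ∃ b, IsAsg M b ∧ AgreeOff i a b ∧ b ∈ᵥ t := by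
  constructor
  · intro h
    obtain ⟨f, h, hf⟩ := h.inv
    simp only [SatRule, isCode_iff, code_inj] at h
    obtain ⟨i', φ', t', -, ⟨rfl, rfl⟩, h₁, h₂⟩ : ∃ i' φ' t, IsNat i' ∧ (i = i' ∧ φ = φ') ∧
      PairMem f φ' t ∧ ∀ a, a ∈ᵥ s ↔
        IsAsg M a ∧ ∃ b, IsAsg M b ∧ AgreeOff i' a b ∧ b ∈ᵥ t := by
      simpa only [OfNat.ofNat_ne_zero, OfNat.ofNat_ne_one, false_and, and_false, exists_false,
        false_or, Nat.reduceEqDiff, true_and] using h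
    rwa [← hu t' (hf _ _ (pairMem_iff.1 h₁))]
  · obtain ⟨f, hf, hm⟩ := ht
    exact fun h => .intro (monotone_satRule M) hf
      (Or.inr (Or.inr (Or.inr (Or.inr ⟨i, φ, t, hi, isCode_iff.2 rfl, pairMem_iff.2 hm, h⟩))))

theorem existsUnique_asgs (M : V) (Q : V → Prop) [DefinablePred fun e : Fin 1 → V => Q (e 0)] :
    ∃! s, ∀ a, a ∈ᵥ s ↔ IsAsg M a ∧ Q a := by
  obtain ⟨s, hs⟩ := exists_sep Q (asgs M)
  simp only [mem_asgs] at hs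
  exact ⟨s, hs, fun s' hs' => ext fun a => by rw [hs a, hs' a]⟩

theorem existsUnique_generated (M : V) {c : V} (hc : IsForm c) :
    ∃! s, Generated (SatRule M) c s := by
  refine form_induction (fun c => ∃! s, Generated (SatRule M) c s) ?_ ?_ ?_ ?_ ?_ hc
  · intro i j hi hj
    simp only [generated_code_zero hi hj]
    exact existsUnique_asgs M fun a => ∃ x y, PairMem a i x ∧ PairMem a j y ∧ x ∈ᵥ y
  · intro i j hi hj
    simp only [generated_code_one hi hj]
    exact existsUnique_asgs M fun a => ∃ x, PairMem a i x ∧ PairMem a j x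
  · rintro φ - ⟨t, ht, hu⟩
    simp only [generated_code_two ht hu]
    exact existsUnique_asgs M fun a => ¬ a ∈ᵥ t
  · rintro φ ψ - - ⟨t, ht, hu⟩ ⟨r, hr, hur⟩
    simp only [generated_code_three ht hu hr hur]
    exact existsUnique_asgs M fun a => a ∈ᵥ t ∧ a ∈ᵥ r
  · rintro i φ hi - ⟨t, ht, hu⟩
    simp only [generated_code_four hi ht hu]
    exact existsUnique_asgs M fun a => ∃ b, IsAsg M b ∧ AgreeOff i a b ∧ b ∈ᵥ t

/-- Tarski's clauses leave elements of `S` other than pairs (formula, assignment) unconstrained.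
Excluding them makes it possible to place `S` in a coding set and to see that `∅ ∉ S`. -/
theorem exists_satRel (M : V) : ∃ S, IsSatRel M S ∧
    ∀ p, p ∈ᵥ S → ∃ φ a, IsForm φ ∧ IsAsg M a ∧ p = opair φ a := by
  obtain ⟨S, hS⟩ := exists_sep_pairs (forms V) (asgs M)
    (fun c a => ∃ s, Generated (SatRule M) c s ∧ a ∈ᵥ s)
  simp only [mem_forms, mem_asgs] at hS
  have hS' : ∀ {c a}, IsForm c → IsAsg M a →
      (PairMem S c a ↔ ∃ s, Generated (SatRule M) c s ∧ a ∈ᵥ s) := by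
    intro c a hc ha
    rw [pairMem_iff, hS]
    constructor
    · rintro ⟨c', a', -, -, he, h⟩
      obtain ⟨rfl, rfl⟩ := opair_inj.1 he
      exact h
    · exact fun h => ⟨c, a, hc, ha, rfl, h⟩
  have hval : ∀ {c t a}, IsForm c → IsAsg M a → Generated (SatRule M) c t →
      (PairMem S c a ↔ a ∈ᵥ t) := by
    intro c t a hc ha ht
    rw [hS' hc ha]
    refine ⟨?_, fun h => ⟨t, ht, h⟩⟩
    rintro ⟨s, hs, h⟩
    rwa [(existsUnique_generated M hc).unique ht hs]
  have hgen : ∀ {c}, IsForm c → ∃ t, Generated (SatRule M) c t ∧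
      ∀ t', Generated (SatRule M) c t' → t' = t := fun hc => existsUnique_generated M hc
  refine ⟨S, fun a ha => ⟨?_, ?_, ?_, ?_, ?_⟩, fun p hp => ?_⟩
  · rintro i j c hi hj hc
    rw [isCode_iff] at hc
    subst hc
    have hc := isForm_code_zero hi hj
    obtain ⟨t, ht, -⟩ := hgen hc
    rw [hval hc ha ht, (generated_code_zero hi hj).1 ht a]
    exact and_iff_right ha
  · rintro i j c hi hj hc
    rw [isCode_iff] at hc
    subst hc
    have hc := isForm_code_one hi hj
    obtain ⟨t, ht, -⟩ := hgen hc
    rw [hval hc ha ht, (generated_code_one hi hj).1 ht a]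
    exact and_iff_right ha
  · rintro φ c hφ hc
    rw [isCode_iff] at hc
    subst hc
    have hc := isForm_code_two hφ
    obtain ⟨t, ht, -⟩ := hgen hc
    obtain ⟨r, hr, hu⟩ := hgen hφ
    rw [hval hc ha ht, hval hφ ha hr, (generated_code_two hr hu).1 ht a]
    exact and_iff_right ha
  · rintro φ ψ c hφ hψ hc
    rw [isCode_iff] at hc
    subst hc
    have hc := isForm_code_three hφ hψ
    obtain ⟨t, ht, -⟩ := hgen hc
    obtain ⟨r, hr, hu⟩ := hgen hφ
    obtain ⟨q, hq, hu'⟩ := hgen hψ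
    rw [hval hc ha ht, hval hφ ha hr, hval hψ ha hq, (generated_code_three hr hu hq hu').1 ht a]
    exact and_iff_right ha
  · rintro i φ c hi hφ hc
    rw [isCode_iff] at hc
    subst hc
    have hc := isForm_code_four hi hφ
    obtain ⟨t, ht, -⟩ := hgen hc
    obtain ⟨r, hr, hu⟩ := hgen hφ
    rw [hval hc ha ht, (generated_code_four hi hr hu).1 ht a, and_iff_right ha]
    exact exists_congr fun b => and_congr_right fun hb => by rw [hval hφ hb hr]
  · obtain ⟨c, a, hc, ha, rfl, -⟩ := (hS p).1 hp
    exact ⟨c, a, hc, ha, rfl⟩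

theorem IsSatRel.unique {M S S' : V} (hS : IsSatRel M S) (hS' : IsSatRel M S') {φ : V}
    (hφ : IsForm φ) : ∀ a, IsAsg M a → (PairMem S φ a ↔ PairMem S' φ a) := by
  refine form_induction (fun φ => ∀ a, IsAsg M a → (PairMem S φ a ↔ PairMem S' φ a))
    ?_ ?_ ?_ ?_ ?_ hφ
  · intro i j hi hj a ha
    rw [(hS a ha).1 i j _ hi hj (isCode_iff.2 rfl), (hS' a ha).1 i j _ hi hj (isCode_iff.2 rfl)]
  · intro i j hi hj a ha
    rw [(hS a ha).2.1 i j _ hi hj (isCode_iff.2 rfl),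
      (hS' a ha).2.1 i j _ hi hj (isCode_iff.2 rfl)]
  · intro φ hφ ih a ha
    rw [(hS a ha).2.2.1 φ _ hφ (isCode_iff.2 rfl), (hS' a ha).2.2.1 φ _ hφ (isCode_iff.2 rfl),
      ih a ha]
  · intro φ ψ hφ hψ ih ih' a ha
    rw [(hS a ha).2.2.2.1 φ ψ _ hφ hψ (isCode_iff.2 rfl),
      (hS' a ha).2.2.2.1 φ ψ _ hφ hψ (isCode_iff.2 rfl), ih a ha, ih' a ha]
  · intro i φ hi hφ ih a ha
    rw [(hS a ha).2.2.2.2 i φ _ hi hφ (isCode_iff.2 rfl),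
      (hS' a ha).2.2.2.2 i φ _ hi hφ (isCode_iff.2 rfl)]
    exact exists_congr fun b => and_congr_right fun hb => by rw [ih b hb]

theorem IsSatRel.sat_iff {M S φ a : V} (hS : IsSatRel M S) (hφ : IsForm φ) (ha : IsAsg M a) :
    Sat M φ a ↔ PairMem S φ a :=
  ⟨fun ⟨_, h, h'⟩ => (h.unique hS hφ a ha).1 h', fun h => ⟨S, hS, h⟩⟩

section Clauses

variable {M a : V} (ha : IsAsg M a)
include ha

theorem sat_code_zero {i j : V} (hi : IsNat i) (hj : IsNat j) :
    Sat M (code 0 i j) a ↔ ∃ x y, PairMem a i x ∧ PairMem a j y ∧ x ∈ᵥ y := by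
  obtain ⟨S, hS, -⟩ := exists_satRel M
  rw [hS.sat_iff (isForm_code_zero hi hj) ha, (hS a ha).1 i j _ hi hj (isCode_iff.2 rfl)]

theorem sat_code_one {i j : V} (hi : IsNat i) (hj : IsNat j) :
    Sat M (code 1 i j) a ↔ ∃ x, PairMem a i x ∧ PairMem a j x := by
  obtain ⟨S, hS, -⟩ := exists_satRel M
  rw [hS.sat_iff (isForm_code_one hi hj) ha, (hS a ha).2.1 i j _ hi hj (isCode_iff.2 rfl)]

theorem sat_code_two {φ : V} (hφ : IsForm φ) : Sat M (code 2 φ φ) a ↔ ¬ Sat M φ a := by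
  obtain ⟨S, hS, -⟩ := exists_satRel M
  rw [hS.sat_iff (isForm_code_two hφ) ha, hS.sat_iff hφ ha,
    (hS a ha).2.2.1 φ _ hφ (isCode_iff.2 rfl)]

theorem sat_code_three {φ ψ : V} (hφ : IsForm φ) (hψ : IsForm ψ) :
    Sat M (code 3 φ ψ) a ↔ Sat M φ a ∧ Sat M ψ a := by
  obtain ⟨S, hS, -⟩ := exists_satRel M
  rw [hS.sat_iff (isForm_code_three hφ hψ) ha, hS.sat_iff hφ ha, hS.sat_iff hψ ha,
    (hS a ha).2.2.2.1 φ ψ _ hφ hψ (isCode_iff.2 rfl)]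

theorem sat_code_four {i φ : V} (hi : IsNat i) (hφ : IsForm φ) :
    Sat M (code 4 i φ) a ↔ ∃ b, IsAsg M b ∧ AgreeOff i a b ∧ Sat M φ b := by
  obtain ⟨S, hS, -⟩ := exists_satRel M
  rw [hS.sat_iff (isForm_code_four hi hφ) ha, (hS a ha).2.2.2.2 i φ _ hi hφ (isCode_iff.2 rfl)]
  exact exists_congr fun b => and_congr_right fun hb => by rw [hS.sat_iff hφ hb]

end Clauses

/-! ### Assignments -/

theorem exists_const_asg {M m : V} (hm : m ∈ᵥ M) :
    ∃ a, IsAsg M a ∧ ∀ k, IsNat k → PairMem a k m := by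
  obtain ⟨a, ha⟩ := exists_sep_pairs (omg V) M fun _ y => y = m
  have h : ∀ k y, PairMem a k y ↔ IsNat k ∧ y = m := by
    intro k y
    rw [pairMem_iff, ha]
    constructor
    · rintro ⟨k', y', hk, -, he, rfl⟩
      obtain ⟨rfl, rfl⟩ := opair_inj.1 he
      exact ⟨mem_omg.1 hk, rfl⟩
    · rintro ⟨hk, rfl⟩
      exact ⟨k, y, mem_omg.2 hk, hm, rfl, rfl⟩
  refine ⟨a, isAsg_iff.2 ⟨fun p hp => ?_, fun k hk => ⟨m, (h k m).2 ⟨mem_omg.1 hk, rfl⟩,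
    fun y hy => ((h k y).1 hy).2⟩⟩, fun k hk => (h k m).2 ⟨hk, rfl⟩⟩
  obtain ⟨x, y, hx, hy, hp, -⟩ := (ha p).1 hp
  exact ⟨x, y, hx, hy, isOPair_iff.2 hp⟩

theorem exists_update {M a i m : V} (ha : IsAsg M a) (hi : IsNat i) (hm : m ∈ᵥ M) :
    ∃ b, IsAsg M b ∧ AgreeOff i a b ∧ PairMem b i m := by
  obtain ⟨b, hb⟩ := exists_sep_pairs (omg V) M fun k y => (k = i ∧ y = m) ∨ (k ≠ i ∧ PairMem a k y)
  have ha' := isAsg_iff.1 ha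
  have h : ∀ k y, PairMem b k y ↔ (k = i ∧ y = m) ∨ (k ≠ i ∧ PairMem a k y) := by
    intro k y
    rw [pairMem_iff, hb]
    constructor
    · rintro ⟨k', y', -, -, he, h⟩
      obtain ⟨rfl, rfl⟩ := opair_inj.1 he
      exact h
    · intro h
      refine ⟨k, y, ?_, ?_, rfl, h⟩
      · rcases h with h | h
        · rw [h.1]; exact mem_omg.2 hi
        · exact (ha'.mem h.2).1
      · rcases h with h | h
        · rw [h.2]; exact hm
        · exact (ha'.mem h.2).2
  refine ⟨b, isAsg_iff.2 ⟨fun p hp => ?_, fun k hk => ?_⟩, fun k hk hki x => ?_,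
    (h i m).2 (Or.inl ⟨rfl, rfl⟩)⟩
  · obtain ⟨x, y, hx, hy, hp, -⟩ := (hb p).1 hp
    exact ⟨x, y, hx, hy, isOPair_iff.2 hp⟩
  · simp only [h]
    by_cases hki : k = i
    · simp [hki]
    · simpa [hki] using ha'.2 k hk
  · rw [h]
    simp [hki]

end Satisfaction

/-! ### Properties expressible in transitive sets -/

section Expressible

variable {V : Type u} [setLang.Structure V]

/-- `P N e` is expressed in every `(N, ∈)` by one formula of the language of set theory. -/
class Expressible {n : ℕ} (P : V → (Fin n → V) → Prop) : Prop where
  out : ∀ A : Type u, ∃ φ : PotFormula A n, φ.IsPureZF ∧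
    ∀ δ v N e, φ.Holds δ v N e ↔ P N e

/-- `t` is a variable. -/
class IsVariable {n : ℕ} (t : (Fin n → V) → V) : Prop where
  out : ∃ k, ∀ e, t e = e k

instance {n : ℕ} (k : Fin n) : IsVariable fun e : Fin n → V => e k := ⟨k, fun _ => rfl⟩

instance {m n : ℕ} {t : (Fin n → V) → V} [ht : IsVariable t]
    (ρ : Fin n → Fin m) : IsVariable fun e : Fin m → V => t fun k => e (ρ k) := by
  obtain ⟨k, hk⟩ := ht.out
  exact ⟨ρ k, fun e => by rw [hk]⟩

namespace Expressible

variable {n : ℕ} {P Q : V → (Fin n → V) → Prop} {s t : (Fin n → V) → V}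

instance mem [hs : IsVariable s] [ht : IsVariable t] : Expressible fun _ e => s e ∈ᵥ t e := by
  obtain ⟨i, hi⟩ := hs.out
  obtain ⟨j, hj⟩ := ht.out
  refine ⟨fun A => ⟨.mem (.inr i) (.inr j), ⟨rfl, rfl⟩, fun δ v N e => ?_⟩⟩
  rw [hi, hj]
  rfl

instance eq [hs : IsVariable s] [ht : IsVariable t] : Expressible fun _ e => s e = t e := by
  obtain ⟨i, hi⟩ := hs.out
  obtain ⟨j, hj⟩ := ht.out
  refine ⟨fun A => ⟨.eq (.inr i) (.inr j), ⟨rfl, rfl⟩, fun δ v N e => ?_⟩⟩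
  rw [hi, hj]
  rfl

instance false : Expressible fun (_ : V) (_ : Fin n → V) => False :=
  ⟨fun _ => ⟨.falsum, trivial, fun _ _ _ _ => Iff.rfl⟩⟩

instance imp [hP : Expressible P] [hQ : Expressible Q] :
    Expressible fun N e => P N e → Q N e := by
  refine ⟨fun A => ?_⟩
  obtain ⟨φ, hφ, h⟩ := hP.out A
  obtain ⟨ψ, hψ, h'⟩ := hQ.out A
  exact ⟨.imp φ ψ, ⟨hφ, hψ⟩, fun δ v N e => imp_congr (h δ v N e) (h' δ v N e)⟩

instance all {P : V → (Fin n → V) → V → Prop}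
    [hP : Expressible fun (N : V) (e : Fin (n + 1) → V) =>
      P N (fun k => e k.castSucc) (e (Fin.last n))] :
    Expressible fun N e => ∀ y, y ∈ᵥ N → P N e y := by
  refine ⟨fun A => ?_⟩
  obtain ⟨φ, hφ, h⟩ := hP.out A
  refine ⟨.all φ, hφ, fun δ v N e => ?_⟩
  simp [PotFormula.Holds, h]

theorem congr (hP : Expressible P) (h : ∀ N e, Q N e ↔ P N e) : Expressible Q :=
  ⟨fun A => (hP.out A).imp fun _ hφ =>
    ⟨hφ.1, fun δ v N e => (hφ.2 δ v N e).trans (h N e).symm⟩⟩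

instance not [Expressible P] : Expressible fun N e => ¬ P N e :=
  inferInstanceAs (Expressible fun N e => P N e → False)

instance and [Expressible P] [Expressible Q] : Expressible fun N e => P N e ∧ Q N e :=
  congr (P := fun N e => ¬ (P N e → ¬ Q N e)) inferInstance fun N e => by tauto

instance or [Expressible P] [Expressible Q] : Expressible fun N e => P N e ∨ Q N e :=
  congr (P := fun N e => ¬ P N e → Q N e) inferInstance fun N e => by tauto

instance iff [Expressible P] [Expressible Q] : Expressible fun N e => P N e ↔ Q N e :=
  congr (P := fun N e => (P N e → Q N e) ∧ (Q N e → P N e)) inferInstance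
    fun N e => by tauto

instance ex {P : V → (Fin n → V) → V → Prop}
    [Expressible fun (N : V) (e : Fin (n + 1) → V) =>
      P N (fun k => e k.castSucc) (e (Fin.last n))] :
    Expressible fun N e => ∃ y, y ∈ᵥ N ∧ P N e y :=
  congr (P := fun N e => ¬ ∀ y, y ∈ᵥ N → ¬ P N e y) inferInstance fun N e => by simp

end Expressible

/-- `x` is empty in `N`. -/
def RelEmpty (N x : V) : Prop := ∀ z, z ∈ᵥ N → ¬ z ∈ᵥ x

/-- `p = {a, b}` in `N`. -/
def RelUPair (N p a b : V) : Prop := ∀ z, z ∈ᵥ N → (z ∈ᵥ p ↔ z = a ∨ z = b)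

/-- `p = {a, b, c}` in `N`. -/
def RelTriple (N p a b c : V) : Prop := ∀ z, z ∈ᵥ N → (z ∈ᵥ p ↔ z = a ∨ z = b ∨ z = c)

/-- `s = a ∪ {a}` in `N`. -/
def RelSucc (N s a : V) : Prop := ∀ z, z ∈ᵥ N → (z ∈ᵥ s ↔ z ∈ᵥ a ∨ z = a)

/-- `p = (a, b)` in `N`. -/
def RelOPair (N p a b : V) : Prop :=
  ∃ s, s ∈ᵥ N ∧ ∃ t, t ∈ᵥ N ∧ RelUPair N s a a ∧ RelUPair N t a b ∧ RelUPair N p s t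

/-- `x` is the numeral `k` in `N`. -/
def RelNum (N : V) : ℕ → V → Prop
  | 0, x => RelEmpty N x
  | k + 1, x => ∃ y, y ∈ᵥ N ∧ RelNum N k y ∧ RelSucc N x y

/-- `x` is an element of no element of `N`. -/
def MaxIn (N x : V) : Prop := ∀ y, y ∈ᵥ N → ¬ x ∈ᵥ y

/-- The assertion that the set `{0, 1, k + 3}` exists. -/
def Button (k : ℕ) (N : V) : Prop :=
  ∃ x, x ∈ᵥ N ∧ ∃ a, a ∈ᵥ N ∧ ∃ b, b ∈ᵥ N ∧ ∃ c, c ∈ᵥ N ∧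
    RelNum N 0 a ∧ RelNum N 1 b ∧ RelNum N (k + 3) c ∧ RelTriple N x a b c

/-- The assertion that some pair with first component `k` is an element of an `∈`-maximal set. -/
def Dial (k : ℕ) (N : V) : Prop :=
  ∃ x, x ∈ᵥ N ∧ MaxIn N x ∧ ∃ z, z ∈ᵥ N ∧ z ∈ᵥ x ∧ ∃ n, n ∈ᵥ N ∧ ∃ y, y ∈ᵥ N ∧
    RelNum N k n ∧ RelOPair N z n y

section Instances

variable {n : ℕ} {r s t q : (Fin n → V) → V}

instance [IsVariable r] : Expressible fun N e => RelEmpty N (r e) := by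
  unfold RelEmpty; infer_instance

instance [IsVariable r] [IsVariable s] [IsVariable t] :
    Expressible fun N e => RelUPair N (r e) (s e) (t e) := by
  unfold RelUPair; infer_instance

instance [IsVariable r] [IsVariable s] [IsVariable t] [IsVariable q] :
    Expressible fun N e => RelTriple N (r e) (s e) (t e) (q e) := by
  unfold RelTriple; infer_instance

instance [IsVariable r] [IsVariable s] : Expressible fun N e => RelSucc N (r e) (s e) := by
  unfold RelSucc; infer_instance

instance [IsVariable r] [IsVariable s] [IsVariable t] :
    Expressible fun N e => RelOPair N (r e) (s e) (t e) := by
  unfold RelOPair; infer_instance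

end Instances

instance {n : ℕ} {r : (Fin n → V) → V} [IsVariable r] (k : ℕ) :
    Expressible fun N e => RelNum N k (r e) := by
  induction k generalizing n with
  | zero => unfold RelNum; infer_instance
  | succ k ih => unfold RelNum; infer_instance

instance {n : ℕ} {r : (Fin n → V) → V} [IsVariable r] : Expressible fun N e => MaxIn N (r e) := by
  unfold MaxIn; infer_instance

instance {n : ℕ} (k : ℕ) : Expressible fun (N : V) (_ : Fin n → V) => Button k N := by
  unfold Button; infer_instance

instance {n : ℕ} (k : ℕ) : Expressible fun (N : V) (_ : Fin n → V) => Dial k N := by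
  unfold Dial; infer_instance

/-! ### Absoluteness for transitive sets -/

section Absoluteness

variable [hV : Fact (IsModelZF V)] {N : V} (hN : IsTrans N)
include hN

theorem relEmpty_iff {x : V} (hx : x ∈ᵥ N) : RelEmpty N x ↔ x = emp V :=
  ⟨fun h => isEmptySet_iff.1 fun z hz => h z (hN x hx z hz) hz, by rintro rfl z _; simp⟩

theorem relUPair_iff {p a b : V} (hp : p ∈ᵥ N) (ha : a ∈ᵥ N) (hb : b ∈ᵥ N) :
    RelUPair N p a b ↔ p = upair a b := by
  refine ⟨fun h => ext fun z => ⟨fun hz => ?_, fun hz => ?_⟩, by rintro rfl z _; simp⟩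
  · exact mem_upair.2 ((h z (hN p hp z hz)).1 hz)
  · have hz := mem_upair.1 hz
    exact (h z (by rcases hz with rfl | rfl <;> assumption)).2 hz

theorem relSucc_iff {s a : V} (hs : s ∈ᵥ N) (ha : a ∈ᵥ N) : RelSucc N s a ↔ s = suc a := by
  refine ⟨fun h => ext fun z => ⟨fun hz => ?_, fun hz => ?_⟩, by rintro rfl z _; simp⟩
  · exact mem_suc.2 ((h z (hN s hs z hz)).1 hz)
  · have hz := mem_suc.1 hz
    refine (h z ?_).2 hz
    rcases hz with hz | rfl
    · exact hN a ha z hz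
    · exact ha

theorem relOPair_iff {p a b : V} (hp : p ∈ᵥ N) (ha : a ∈ᵥ N) (hb : b ∈ᵥ N) :
    RelOPair N p a b ↔ p = opair a b := by
  constructor
  · rintro ⟨s, hs, t, ht, h₁, h₂, h₃⟩
    rw [relUPair_iff hN hs ha ha] at h₁
    rw [relUPair_iff hN ht ha hb] at h₂
    rw [relUPair_iff hN hp hs ht] at h₃
    rw [h₃, h₁, h₂]; rfl
  · rintro rfl
    have h₁ : upair a a ∈ᵥ N := hN _ hp _ (mem_upair.2 (Or.inl rfl))
    have h₂ : upair a b ∈ᵥ N := hN _ hp _ (mem_upair.2 (Or.inr rfl))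
    exact ⟨_, h₁, _, h₂, (relUPair_iff hN h₁ ha ha).2 rfl, (relUPair_iff hN h₂ ha hb).2 rfl,
      (relUPair_iff hN hp h₁ h₂).2 rfl⟩

theorem relNum_iff {k : ℕ} {x : V} (hx : x ∈ᵥ N) : RelNum N k x ↔ x = num V k := by
  induction k generalizing x with
  | zero => exact relEmpty_iff hN hx
  | succ k ih =>
    constructor
    · rintro ⟨y, hy, h, h'⟩
      rw [(relSucc_iff hN hx hy).1 h', (ih hy).1 h]; rfl
    · rintro rfl
      have hk : num V k ∈ᵥ N := hN _ hx _ (mem_suc.2 (Or.inr rfl))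
      exact ⟨_, hk, (ih hk).2 rfl, (relSucc_iff hN hx hk).2 rfl⟩

omit hN in
variable (V) in
/-- The set `{0, 1, k + 3}`. -/
noncomputable def buttonSet (k : ℕ) : V :=
  union (upair (num V 0) (num V 1)) (upair (num V (k + 3)) (num V (k + 3)))

omit hN in
theorem mem_buttonSet {k : ℕ} {z : V} :
    z ∈ᵥ buttonSet V k ↔ z = num V 0 ∨ z = num V 1 ∨ z = num V (k + 3) := by
  simp [buttonSet, or_assoc]

theorem button_iff {k : ℕ} : Button k N ↔ buttonSet V k ∈ᵥ N := by
  constructor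
  · rintro ⟨x, hx, a, ha, b, hb, c, hc, h0, h1, h2, h⟩
    rw [relNum_iff hN ha] at h0
    rw [relNum_iff hN hb] at h1
    rw [relNum_iff hN hc] at h2
    subst h0 h1 h2
    have : x = buttonSet V k := ext fun z => by
      rw [mem_buttonSet]
      refine ⟨fun hz => (h z (hN x hx z hz)).1 hz, fun hz => (h z ?_).2 hz⟩
      rcases hz with rfl | rfl | rfl <;> assumption
    exact this ▸ hx
  · intro h
    have h0 : num V 0 ∈ᵥ N := hN _ h _ (mem_buttonSet.2 (by simp))
    have h1 : num V 1 ∈ᵥ N := hN _ h _ (mem_buttonSet.2 (by simp))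
    have h2 : num V (k + 3) ∈ᵥ N := hN _ h _ (mem_buttonSet.2 (by simp))
    exact ⟨_, h, _, h0, _, h1, _, h2, (relNum_iff hN h0).2 rfl, (relNum_iff hN h1).2 rfl,
      (relNum_iff hN h2).2 rfl, fun z _ => mem_buttonSet⟩

theorem dial_iff {k : ℕ} :
    Dial k N ↔ ∃ x, x ∈ᵥ N ∧ MaxIn N x ∧ ∃ y, opair (num V k) y ∈ᵥ x := by
  constructor
  · rintro ⟨x, hx, hm, z, hz, hzx, n, hn, y, hy, h, h'⟩
    rw [relNum_iff hN hn] at h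
    rw [relOPair_iff hN hz hn hy, h] at h'
    exact ⟨x, hx, hm, y, h' ▸ hzx⟩
  · rintro ⟨x, hx, hm, y, h⟩
    have hz := hN x hx _ h
    obtain ⟨hn, hy⟩ := mem_of_opair_mem hN hz
    exact ⟨x, hx, hm, _, hz, h, _, hn, y, hy, (relNum_iff hN hn).2 rfl,
      (relOPair_iff hN hz hn hy).2 rfl⟩

end Absoluteness

/-! ### Codes of standard formulas -/

variable [hV : Fact (IsModelZF V)]

variable (V) in
/-- Every standard formula of the language of set theory has a code in `V`. -/
theorem exists_code {A : Type u} {n : ℕ} (φ : PotFormula A n) (hφ : φ.IsPureZF) :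
    ∃ c : V, IsForm c ∧ ∀ (δ : V) (v : A → V) (N a : V) (e : Fin n → V), IsAsg N a →
      (∀ k : Fin n, PairMem a (num V k) (e k)) → (Sat N c a ↔ φ.Holds δ v N e) := by
  induction φ with
  | @mem n s t =>
    rcases s with s | i
    · simp [PotFormula.IsPureZF] at hφ
    rcases t with t | j
    · simp [PotFormula.IsPureZF] at hφ
    refine ⟨_, isForm_code_zero (isNat_num i) (isNat_num j), fun δ v N a e ha he => ?_⟩
    rw [sat_code_zero ha (isNat_num i) (isNat_num j)]
    have ha' := isAsg_iff.1 ha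
    constructor
    · rintro ⟨x, y, hx, hy, h⟩
      rw [ha'.unique (ha'.mem hx).1 hx (he i), ha'.unique (ha'.mem hy).1 hy (he j)] at h
      exact h
    · exact fun h => ⟨_, _, he i, he j, h⟩
  | @eq n s t =>
    rcases s with s | i
    · simp [PotFormula.IsPureZF] at hφ
    rcases t with t | j
    · simp [PotFormula.IsPureZF] at hφ
    refine ⟨_, isForm_code_one (isNat_num i) (isNat_num j), fun δ v N a e ha he => ?_⟩
    rw [sat_code_one ha (isNat_num i) (isNat_num j)]
    have ha' := isAsg_iff.1 ha
    constructor
    · rintro ⟨x, hx, hy⟩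
      exact (ha'.unique (ha'.mem hx).1 hx (he i)).symm.trans (ha'.unique (ha'.mem hy).1 hy (he j))
    · intro h
      have h : e i = e j := h
      exact ⟨_, he i, h ▸ he j⟩
  | falsum =>
    have h1 := isForm_code_one (isNat_num (V := V) 0) (isNat_num 0)
    refine ⟨_, isForm_code_two h1, fun δ v N a e ha he => ?_⟩
    rw [sat_code_two ha h1, sat_code_one ha (isNat_num 0) (isNat_num 0)]
    obtain ⟨x, hx, -⟩ := (isAsg_iff.1 ha).2 _ (mem_omg.2 (isNat_num 0))
    exact iff_of_false (fun h => h ⟨x, hx, hx⟩) id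
  | imp φ ψ ih ih' =>
    obtain ⟨c, hc, h⟩ := ih hφ.1
    obtain ⟨c', hc', h'⟩ := ih' hφ.2
    refine ⟨_, isForm_code_two (isForm_code_three hc (isForm_code_two hc')),
      fun δ v N a e ha he => ?_⟩
    rw [sat_code_two ha (isForm_code_three hc (isForm_code_two hc')),
      sat_code_three ha hc (isForm_code_two hc'), sat_code_two ha hc', h δ v N a e ha he,
      h' δ v N a e ha he, not_and_not_right]
    rfl
  | @all n φ ih =>
    obtain ⟨c, hc, h⟩ := ih hφ
    -- The free variables of the quantified formula are numbered below `n`, so the bound one is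
    -- `xₙ`, matching the last place of `Fin.snoc`.
    refine ⟨_, isForm_code_two (isForm_code_four (isNat_num n) (isForm_code_two hc)),
      fun δ v N a e ha he => ?_⟩
    rw [sat_code_two ha (isForm_code_four (isNat_num n) (isForm_code_two hc)),
      sat_code_four ha (isNat_num n) (isForm_code_two hc)]
    have key : ∀ b y, IsAsg N b → AgreeOff (num V n) a b → PairMem b (num V n) y →
        (Sat N c b ↔ φ.Holds δ v N (Fin.snoc e y)) := by
      intro b y hb hag hy
      refine h δ v N b _ hb fun k => ?_
      refine Fin.lastCases ?_ (fun k => ?_) k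
      · simpa using hy
      · rw [Fin.snoc_castSucc, Fin.val_castSucc]
        exact (hag _ (isNat_num _) (by simpa using k.2.ne) _).1 (he k)
    constructor
    · intro hn y hy
      obtain ⟨b, hb, hag, hby⟩ := exists_update ha (isNat_num n) hy
      by_contra hcon
      exact hn ⟨b, hb, hag, (sat_code_two hb hc).2 fun hs => hcon ((key b y hb hag hby).1 hs)⟩
    · rintro hall ⟨b, hb, hag, hs⟩
      obtain ⟨y, hy, -⟩ := (isAsg_iff.1 hb).2 _ (mem_omg.2 (isNat_num n))
      exact (sat_code_two hb hc).1 hs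
        ((key b y hb hag hy).2 (hall y ((isAsg_iff.1 hb).mem hy).2))
  | box φ => exact hφ.elim
  | dia φ => exact hφ.elim

theorem exists_asg_of_env {N m : V} (hm : m ∈ᵥ N) {n : ℕ} (e : Fin n → V)
    (he : ∀ k, e k ∈ᵥ N) : ∃ a, IsAsg N a ∧ ∀ k : Fin n, PairMem a (num V k) (e k) := by
  induction n with
  | zero =>
    obtain ⟨a, ha, -⟩ := exists_const_asg hm
    exact ⟨a, ha, fun k => k.elim0⟩
  | succ n ih =>
    obtain ⟨a, ha, h⟩ := ih (fun k => e k.castSucc) fun k => he _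
    obtain ⟨b, hb, hag, hy⟩ := exists_update ha (isNat_num n) (he (Fin.last n))
    refine ⟨b, hb, fun k => Fin.lastCases (by simpa using hy) (fun k => ?_) k⟩
    rw [Fin.val_castSucc]
    exact (hag _ (isNat_num _) (by simpa using k.2.ne) _).1 (h k)

theorem exists_comp_asg {M N j a : V} (hj : IsFun j M N) (ha : IsAsg M a) :
    ∃ b, IsAsg N b ∧ ∀ k x y, PairMem a k x → (PairMem b k y ↔ PairMem j x y) := by
  have ha' := isAsg_iff.1 ha
  obtain ⟨b, hb⟩ := exists_sep_pairs (omg V) N fun k y => ∃ x, PairMem a k x ∧ PairMem j x y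
  have h : ∀ k x y, PairMem a k x → (PairMem b k y ↔ PairMem j x y) := by
    intro k x y hx
    rw [pairMem_iff, hb]
    constructor
    · rintro ⟨k', y', hk, -, he, x', hx', hy⟩
      obtain ⟨rfl, rfl⟩ := opair_inj.1 he
      rwa [ha'.unique hk hx hx']
    · intro hy
      exact ⟨k, y, (ha'.mem hx).1, (hj.mem hy).2, rfl, x, hx, hy⟩
  refine ⟨b, isAsg_iff.2 ⟨fun p hp => ?_, fun k hk => ?_⟩, h⟩
  · obtain ⟨x, y, hx, hy, hp, -⟩ := (hb p).1 hp
    exact ⟨x, y, hx, hy, isOPair_iff.2 hp⟩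
  · obtain ⟨x, hx, -⟩ := ha'.2 k hk
    simp only [fun y => h k x y hx]
    exact hj.2 x (ha'.mem hx).2

/-- `J` is the function on `N` given by `j`, and it preserves expressible properties. -/
structure IsElemMap (j N : V) (J : V → V) : Prop where
  pairMem_iff {x : V} (hx : x ∈ᵥ N) {y : V} : PairMem j x y ↔ y = J x
  mem {x : V} (hx : x ∈ᵥ N) : J x ∈ᵥ N
  iff {n : ℕ} (P : V → (Fin n → V) → Prop) [Expressible P] (e : Fin n → V)
    (he : ∀ k, e k ∈ᵥ N) : P N e ↔ P N fun k => J (e k)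

/-- Internal elementarity covers all codes in `V`; the codes of standard formulas suffice for what
follows. The element `m` fills the irrelevant places of an assignment. -/
theorem IsElemEmb.exists_isElemMap {j N m : V} (hj : IsElemEmb j N N) (hm : m ∈ᵥ N) :
    ∃ J, IsElemMap j N J := by
  have hex : ∀ x, ∃ y, x ∈ᵥ N → PairMem j x y := fun x => by
    by_cases hx : x ∈ᵥ N
    · obtain ⟨y, hy, -⟩ := hj.1.2 x hx
      exact ⟨y, fun _ => hy⟩
    · exact ⟨x, fun h => (hx h).elim⟩
  choose J hJ using hex
  refine ⟨J, fun {x} hx {y} => ⟨fun h => hj.1.unique hx h (hJ x hx), fun h => h ▸ hJ x hx⟩,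
    fun {x} hx => (hj.1.mem (hJ x hx)).2, fun {n} P hP e he => ?_⟩
  obtain ⟨φ, hφ, h⟩ := hP.out PEmpty
  obtain ⟨c, hc, hs⟩ := exists_code V φ hφ
  obtain ⟨a, ha, hae⟩ := exists_asg_of_env hm e he
  obtain ⟨b, hb, hab⟩ := exists_comp_asg hj.1 ha
  rw [← h m PEmpty.elim N e, ← h m PEmpty.elim N, ← hs m _ N a e ha hae, ← hs m _ N b _ hb]
  · exact hj.2 c a b hc ha hb fun k x y hx hy => (hab k x y hx).1 hy
  · exact fun k => (hab _ _ _ (hae k)).2 (hJ _ (he k))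

/-! ### What elementary self-maps of transitive sets preserve and fix -/

namespace IsElemMap

variable {j N : V} {J : V → V} (h : IsElemMap j N J) (hN : IsTrans N)
include h

omit hV in
theorem mem_iff {x y : V} (hx : x ∈ᵥ N) (hy : y ∈ᵥ N) : x ∈ᵥ y ↔ J x ∈ᵥ J y :=
  h.iff (fun _ (e : Fin 2 → V) => e 0 ∈ᵥ e 1) ![x, y] (by simp [Fin.forall_fin_two, hx, hy])

omit hV in
theorem maxIn {x : V} (hx : x ∈ᵥ N) (hm : MaxIn N x) : MaxIn N (J x) :=
  (h.iff (fun N (e : Fin 1 → V) => MaxIn N (e 0)) ![x] (by simp [hx])).1 hm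

include hN

theorem map_emp (h0 : emp V ∈ᵥ N) : J (emp V) = emp V :=
  (relEmpty_iff hN (h.mem h0)).1 ((h.iff (fun N (e : Fin 1 → V) => RelEmpty N (e 0)) ![emp V]
    (by simp [h0])).1 ((relEmpty_iff hN h0).2 rfl))

theorem map_suc {x : V} (hs : suc x ∈ᵥ N) : J (suc x) = suc (J x) :=
  have hx := hN _ hs _ (mem_suc.2 (Or.inr rfl))
  (relSucc_iff hN (h.mem hs) (h.mem hx)).1
    ((h.iff (fun N (e : Fin 2 → V) => RelSucc N (e 0) (e 1)) ![suc x, x]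
      (by simp [Fin.forall_fin_two, hx, hs])).1 ((relSucc_iff hN hs hx).2 rfl))

theorem map_upair {x y : V} (hp : upair x y ∈ᵥ N) : J (upair x y) = upair (J x) (J y) :=
  have hx := hN _ hp _ (mem_upair.2 (Or.inl rfl))
  have hy := hN _ hp _ (mem_upair.2 (Or.inr rfl))
  (relUPair_iff hN (h.mem hp) (h.mem hx) (h.mem hy)).1
    ((h.iff (fun N (e : Fin 3 → V) => RelUPair N (e 0) (e 1) (e 2)) ![upair x y, x, y]
      (by simp [Fin.forall_fin_succ, hx, hy, hp])).1 ((relUPair_iff hN hp hx hy).2 rfl))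

theorem map_opair {x y : V} (hp : opair x y ∈ᵥ N) : J (opair x y) = opair (J x) (J y) := by
  have h₁ : upair x x ∈ᵥ N := hN _ hp _ (mem_upair.2 (Or.inl rfl))
  have h₂ : upair x y ∈ᵥ N := hN _ hp _ (mem_upair.2 (Or.inr rfl))
  rw [opair, h.map_upair hN hp, h.map_upair hN h₁, h.map_upair hN h₂, opair]

theorem map_components {x y : V} (hp : opair x y ∈ᵥ N) (hJ : J (opair x y) = opair x y) :
    J x = x ∧ J y = y := by
  rwa [h.map_opair hN hp, opair_inj] at hJ

/-- The number `n` may be nonstandard, so the induction is internal. It is phrased with the set `j`,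
since the external function `J` may not occur in a definable predicate. -/
theorem map_nat (hω : ∀ n, IsNat n → n ∈ᵥ N) {n : V} (hn : IsNat n) : J n = n := by
  rw [eq_comm, ← h.pairMem_iff (hω n hn)]
  refine nat_induction (fun n => PairMem j n n) ?_ (fun n hn ih => ?_) hn
  · rw [h.pairMem_iff (hω _ isNat_emp), h.map_emp hN (hω _ isNat_emp)]
  · rw [h.pairMem_iff (hω _ hn)] at ih
    rw [h.pairMem_iff (hω _ (isNat_suc hn)), h.map_suc hN (hω _ (isNat_suc hn)), ← ih]

theorem map_code (hω : ∀ n, IsNat n → n ∈ᵥ N) {k : ℕ} {a b : V} (hc : code k a b ∈ᵥ N)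
    (ha : J a = a) (hb : J b = b) : J (code k a b) = code k a b := by
  rw [code, h.map_opair hN hc, h.map_opair hN (mem_of_opair_mem hN hc).2,
    h.map_nat hN hω (isNat_num k), ha, hb]

theorem map_form (hω : ∀ n, IsNat n → n ∈ᵥ N) (hF : ∀ φ, IsForm φ → φ ∈ᵥ N) {φ : V}
    (hφ : IsForm φ) : J φ = φ := by
  rw [eq_comm, ← h.pairMem_iff (hF φ hφ)]
  have key : ∀ {k a b}, IsForm (code k a b) → J a = a → J b = b →
      PairMem j (code k a b) (code k a b) := by
    intro k a b hc ha hb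
    rw [h.pairMem_iff (hF _ hc), h.map_code hN hω (hF _ hc) ha hb]
  have hn : ∀ {i}, IsNat i → J i = i := fun hi => h.map_nat hN hω hi
  refine form_induction (fun φ => PairMem j φ φ) ?_ ?_ ?_ ?_ ?_ hφ
  · exact fun i j hi hj => key (isForm_code_zero hi hj) (hn hi) (hn hj)
  · exact fun i j hi hj => key (isForm_code_one hi hj) (hn hi) (hn hj)
  · intro φ hφ ih
    rw [h.pairMem_iff (hF _ hφ)] at ih
    exact key (isForm_code_two hφ) ih.symm ih.symm
  · intro φ ψ hφ hψ ih ih'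
    rw [h.pairMem_iff (hF _ hφ)] at ih
    rw [h.pairMem_iff (hF _ hψ)] at ih'
    exact key (isForm_code_three hφ hψ) ih.symm ih'.symm
  · intro i φ hi hφ ih
    rw [h.pairMem_iff (hF _ hφ)] at ih
    exact key (isForm_code_four hi hφ) (hn hi) ih.symm

/-- An elementary self-map of `N` that fixes `M` and its satisfaction relation restricts to an
elementary self-map of `M`. -/
theorem exists_restrict {M S : V} (hω : ∀ n, IsNat n → n ∈ᵥ N) (hF : ∀ φ, IsForm φ → φ ∈ᵥ N)
    (hM : M ∈ᵥ N) (hA : asgs M ∈ᵥ N) (hS : S ∈ᵥ N) (hJM : J M = M) (hJA : J (asgs M) = asgs M)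
    (hJS : J S = S) (hsat : IsSatRel M S)
    (hp : ∀ φ a, IsForm φ → IsAsg M a → opair φ a ∈ᵥ N) :
    ∃ j', IsElemEmb j' M M ∧ ∀ x, x ∈ᵥ M → ∀ y, PairMem j' x y ↔ PairMem j x y := by
  have hMN : ∀ x, x ∈ᵥ M → x ∈ᵥ N := hN M hM
  have hmap : ∀ x, x ∈ᵥ M → J x ∈ᵥ M := fun x hx => by
    have := (h.mem_iff (hMN x hx) hM).1 hx
    rwa [hJM] at this
  obtain ⟨j', hj'⟩ := exists_sep_pairs M M fun x y => PairMem j x y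
  have hj : ∀ x, x ∈ᵥ M → ∀ y, PairMem j' x y ↔ PairMem j x y := by
    intro x hx y
    rw [Potentialism.pairMem_iff, hj']
    constructor
    · rintro ⟨x', y', -, -, he, hxy⟩
      obtain ⟨rfl, rfl⟩ := opair_inj.1 he
      exact hxy
    · intro hxy
      have := (h.pairMem_iff (hMN x hx)).1 hxy
      exact ⟨x, y, hx, this ▸ hmap x hx, rfl, hxy⟩
  have hfun : IsFun j' M M := by
    refine ⟨fun p hp => ?_, fun x hx => ?_⟩
    · obtain ⟨x, y, hx, hy, hp, -⟩ := (hj' p).1 hp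
      exact ⟨x, y, hx, hy, isOPair_iff.2 hp⟩
    · simp only [hj x hx, h.pairMem_iff (hMN x hx)]
      exact ⟨J x, rfl, fun _ h => h⟩
  refine ⟨j', ⟨hfun, fun φ a b hφ ha hb hab => ?_⟩, hj⟩
  have haN : a ∈ᵥ N := hN _ hA _ (mem_asgs.2 ha)
  have hJa : IsAsg M (J a) := by
    have := (h.mem_iff haN hA).1 (mem_asgs.2 ha)
    rwa [hJA, mem_asgs] at this
  have ha' := isAsg_iff.1 ha
  have hb' := isAsg_iff.1 hb
  have hJa' := isAsg_iff.1 hJa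
  -- `J` fixes the index `k`, so it sends the pair `(k, x)` of `a` to `(k, J x)`; hence `J a` is `J
  -- ∘ a`, which is `b`.
  have hsub : ∀ k y, PairMem b k y → PairMem (J a) k y := by
    intro k y hy
    have hk := (hb'.mem hy).1
    obtain ⟨x, hx, -⟩ := ha'.2 k hk
    have hxM := (ha'.mem hx).2
    obtain rfl := (h.pairMem_iff (hMN x hxM)).1 ((hj x hxM y).1 (hab k x y hx hy))
    rw [Potentialism.pairMem_iff] at hx ⊢
    have hpN := hN _ haN _ hx
    have := (h.mem_iff hpN haN).1 hx
    rwa [h.map_opair hN hpN, h.map_nat hN hω (mem_omg.1 hk)] at this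
  have hJab : J a = b := by
    refine ext fun p => ⟨fun hp => ?_, fun hp => ?_⟩
    · obtain ⟨k, y, hk, hy, hp'⟩ := hJa'.1 p hp
      rw [isOPair_iff] at hp'
      subst hp'
      obtain ⟨y', hy', -⟩ := hb'.2 k hk
      rw [← Potentialism.pairMem_iff] at hp
      rw [hJa'.unique hk hp (hsub k y' hy')]
      exact Potentialism.pairMem_iff.1 hy'
    · obtain ⟨k, y, hk, hy, hp'⟩ := hb'.1 p hp
      rw [isOPair_iff] at hp'
      subst hp'
      exact Potentialism.pairMem_iff.1 (hsub k y (Potentialism.pairMem_iff.2 hp))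
  -- Truth of `φ`, standard or not, is now a single membership in `S`, and preservation of `∈`
  -- settles it.
  rw [hsat.sat_iff hφ ha, hsat.sat_iff hφ hb, Potentialism.pairMem_iff, Potentialism.pairMem_iff,
    h.mem_iff (hp φ a hφ ha) hS, hJS, h.map_opair hN (hp φ a hφ ha), h.map_form hN hω hF hφ, hJab]

end IsElemMap

end Expressible

/-! ### Extending worlds -/

section Extension

variable {V : Type u} [setLang.Structure V] [hV : Fact (IsModelZF V)]

/-- Sets that are not needed for coding: they have `∅` as an element, and are neither transitive
nor unordered pairs. -/
structure IsWild (x : V) : Prop where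
  emp_mem : emp V ∈ᵥ x
  not_isTrans : ¬ IsTrans x
  ne_upair (a b : V) : x ≠ upair a b

theorem upair_ne_emp {a b : V} : upair a b ≠ emp V := fun h =>
  not_mem_emp (h ▸ mem_upair.2 (Or.inl rfl) : a ∈ᵥ emp V)

theorem opair_ne_emp {a b : V} : opair a b ≠ emp V := upair_ne_emp

theorem emp_not_mem_opair {a b : V} : ¬ emp V ∈ᵥ opair a b := fun h => by
  rcases mem_upair.1 h with h | h <;> exact upair_ne_emp h.symm

/-- The offset 3 keeps the predecessor `k + 2` of the last element different from 0 and 1, so it is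
missing and transitivity fails; three distinct elements rule out a pair. -/
theorem isWild_buttonSet (k : ℕ) : IsWild (buttonSet V k) := by
  refine ⟨mem_buttonSet.2 (Or.inl rfl), fun h => ?_, fun a b h => ?_⟩
  · have h3 : num V (k + 3) ∈ᵥ buttonSet V k := mem_buttonSet.2 (by simp)
    have h2 : num V (k + 2) ∈ᵥ buttonSet V k := h _ h3 _ (mem_suc.2 (Or.inr rfl))
    simp [mem_buttonSet] at h2
  · have h0 : num V 0 ∈ᵥ upair a b := h ▸ mem_buttonSet.2 (by simp)
    have h1 : num V 1 ∈ᵥ upair a b := h ▸ mem_buttonSet.2 (by simp)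
    have h3 : num V (k + 3) ∈ᵥ upair a b := h ▸ mem_buttonSet.2 (by simp)
    rw [mem_upair] at h0 h1 h3
    have h01 : num V 0 ≠ num V 1 := by simp
    have h03 : num V 0 ≠ num V (k + 3) := by simp
    have h13 : num V 1 ≠ num V (k + 3) := by simp
    grind

/-- A transitive set coding `M` with its satisfaction relation, so that elementary self-maps
fixing the code restrict to `M`. -/
structure IsCoding (T M S : V) : Prop where
  trans : IsTrans T
  nat {n : V} : IsNat n → n ∈ᵥ T
  opair {x y : V} : x ∈ᵥ T → y ∈ᵥ T → opair x y ∈ᵥ T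
  form {φ : V} : IsForm φ → φ ∈ᵥ T
  sub : Sub M T
  mem : M ∈ᵥ T
  asgs_mem : asgs M ∈ᵥ T
  satRel : IsSatRel M S
  satRel_mem : S ∈ᵥ T

/-- Two transitive sets can be coded in a transitive set that avoids any prescribed wild sets
that are not yet present, and only those. -/
theorem exists_isCoding {M₁ M₂ C : V} (h₁ : IsTrans M₁) (h₂ : IsTrans M₂)
    (hC : ∀ x, x ∈ᵥ C → IsWild x ∧ ¬ x ∈ᵥ M₁ ∧ ¬ x ∈ᵥ M₂) :
    ∃ T S₁ S₂, IsCoding T M₁ S₁ ∧ IsCoding T M₂ S₂ ∧ (∀ x, x ∈ᵥ C → ¬ x ∈ᵥ T) ∧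
      ∀ x, Sub x (omg V) → ¬ x ∈ᵥ C → x ∈ᵥ T := by
  obtain ⟨U, hU, hωU⟩ := exists_isUniverse (isTrans_omg (V := V))
  have huT : IsTrans (union U (union M₁ M₂)) := isTrans_union hU.trans (isTrans_union h₁ h₂)
  obtain ⟨u, hu⟩ : ∃ u, u = union U (union M₁ M₂) := ⟨_, rfl⟩
  rw [← hu] at huT
  obtain ⟨B, hB, huB⟩ := exists_isUniverse huT
  have hUu : Sub U u := fun x hx => by rw [hu]; simp [hx]
  have hωu : Sub (omg V) u := Sub.trans (hU.trans _ hωU) hUu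
  have hFu : ∀ φ, IsForm φ → φ ∈ᵥ u := fun φ hφ => hUu _ (hφ U
    (formClosed_of_opair (hU.trans _ hωU) fun x y => hU.opair))
  have hM₁u : Sub M₁ u := fun x hx => by rw [hu]; simp [hx]
  have hM₂u : Sub M₂ u := fun x hx => by rw [hu]; simp [hx]
  -- `T` collects the sets in `B` that hereditarily avoid `C`. By `hcl` below, it contains every
  -- subset of itself that lies in `B` and not in `C`.
  obtain ⟨T, hT⟩ := exists_sep
    (fun x => ∃ t, IsTrans t ∧ x ∈ᵥ t ∧ ∀ y, y ∈ᵥ t → ¬ y ∈ᵥ C) B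
  have hTtr : IsTrans T := fun x hx y hy => by
    obtain ⟨hxB, t, ht, hxt, hd⟩ := (hT x).1 hx
    exact (hT y).2 ⟨hB.trans x hxB y hy, t, ht, ht x hxt y hy, hd⟩
  have hTC : ∀ x, x ∈ᵥ T → ¬ x ∈ᵥ C := fun x hx => by
    obtain ⟨-, t, -, hxt, hd⟩ := (hT x).1 hx
    exact hd x hxt
  have hTB : Sub T B := fun x hx => ((hT x).1 hx).1
  have hcl : ∀ z, z ∈ᵥ B → Sub z T → ¬ z ∈ᵥ C → z ∈ᵥ T := by
    intro z hz hzT hzC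
    refine (hT z).2 ⟨hz, union T (upair z z), fun x hx y hy => mem_union.2 (Or.inl ?_), by simp, ?_⟩
    · rcases mem_union.1 hx with hx | hx
      · exact hTtr x hx y hy
      · obtain rfl : x = z := by simpa using hx
        exact hzT y hy
    · intro y hy
      rcases mem_union.1 hy with hy | hy
      · exact hTC y hy
      · obtain rfl : y = z := by simpa using hy
        exact hzC
  -- Each object of the coding escapes `C` for one of three reasons: worlds and numbers are
  -- transitive; assignments, the set of them and `S` lack `∅`; ordered pairs, hence formulas, are
  -- built from unordered pairs.
  have htrC : ∀ x, IsTrans x → ¬ x ∈ᵥ C := fun x hx h => (hC x h).1.not_isTrans hx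
  have hempC : ∀ x, ¬ emp V ∈ᵥ x → ¬ x ∈ᵥ C := fun x hx h => hx (hC x h).1.emp_mem
  have hupair : ∀ {x y}, x ∈ᵥ T → y ∈ᵥ T → upair x y ∈ᵥ T := by
    intro x y hx hy
    refine hcl _ (hB.upair (hTB _ hx) (hTB _ hy)) (fun z hz => ?_) fun h =>
      (hC _ h).1.ne_upair x y rfl
    rcases mem_upair.1 hz with rfl | rfl <;> assumption
  have hopair : ∀ {x y}, x ∈ᵥ T → y ∈ᵥ T → opair x y ∈ᵥ T := fun hx hy =>
    hupair (hupair hx hx) (hupair hx hy)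
  have hω : Sub (omg V) T := fun n hn => (hT n).2 ⟨hB.trans u huB n (hωu n hn), omg V,
    isTrans_omg, hn, fun y hy => htrC y (isNat_isTrans (mem_omg.1 hy))⟩
  have hF : ∀ {φ}, IsForm φ → φ ∈ᵥ T := fun hφ =>
    hφ T (formClosed_of_opair hω fun x y => hopair)
  have key : ∀ M, IsTrans M → Sub M u → (∀ x, x ∈ᵥ C → ¬ x ∈ᵥ M) → ∃ S, IsCoding T M S := by
    intro M hM hMu hMC
    have hsub : Sub M T := fun x hx =>
      (hT x).2 ⟨hB.trans u huB x (hMu x hx), M, hM, hx, fun y hy hyC => hMC y hyC hy⟩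
    have hMT : M ∈ᵥ T := hcl M (hB.sub huB hMu) hsub (htrC M hM)
    have hasgpow : ∀ a, IsAsg M a → Sub a (pow (pow u)) := by
      intro a ha p hp
      obtain ⟨x, y, hx, hy, hp⟩ := (isAsg_iff.1 ha).1 p hp
      rw [isOPair_iff.1 hp]
      exact opair_mem_pow (hωu x hx) (hMu y hy)
    have hasg : ∀ a, IsAsg M a → a ∈ᵥ T := by
      intro a ha
      refine hcl a (hB.sub (hB.pow (hB.pow huB)) (hasgpow a ha)) (fun p hp => ?_)
        (hempC a fun h => ?_)
      · obtain ⟨x, y, hx, hy, hp⟩ := (isAsg_iff.1 ha).1 p hp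
        rw [isOPair_iff.1 hp]
        exact hopair (hω x hx) (hsub y hy)
      · obtain ⟨x, y, hx, hy, hp⟩ := (isAsg_iff.1 ha).1 _ h
        exact opair_ne_emp (isOPair_iff.1 hp).symm
    have hAB : asgs M ∈ᵥ B := hB.sub (hB.pow (hB.pow (hB.pow huB))) fun a ha =>
      mem_pow.2 (hasgpow a (mem_asgs.1 ha))
    have hAT : asgs M ∈ᵥ T := hcl _ hAB (fun a ha => hasg a (mem_asgs.1 ha)) (hempC _ fun h => by
      obtain ⟨y, hy, -⟩ := (isAsg_iff.1 (mem_asgs.1 h)).2 _ (mem_omg.2 isNat_emp)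
      exact not_mem_emp (pairMem_iff.1 hy))
    obtain ⟨S, hS, hSp⟩ := exists_satRel M
    refine ⟨S, hTtr, fun hn => hω _ (mem_omg.2 hn), hopair, hF, hsub, hMT, hAT, hS, ?_⟩
    refine hcl S (hB.relation (v := union u (asgs M)) (hB.union huB hAB) fun p hp => ?_)
      (fun p hp => ?_) (hempC _ fun h => ?_)
    · obtain ⟨φ, a, hφ, ha, hp⟩ := hSp p hp
      exact ⟨φ, a, mem_union.2 (Or.inl (hFu φ hφ)), mem_union.2 (Or.inr (mem_asgs.2 ha)), hp⟩
    · obtain ⟨φ, a, hφ, ha, hp⟩ := hSp p hp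
      exact hp ▸ hopair (hF hφ) (hasg a ha)
    · obtain ⟨φ, a, -, -, hp⟩ := hSp _ h
      exact opair_ne_emp hp.symm
  obtain ⟨S₁, hS₁⟩ := key M₁ h₁ hM₁u fun x hx => (hC x hx).2.1
  obtain ⟨S₂, hS₂⟩ := key M₂ h₂ hM₂u fun x hx => (hC x hx).2.2
  exact ⟨T, S₁, S₂, hS₁, hS₂, fun x hxC hxT => hTC x hxT hxC, fun x hx hxC =>
    hcl x (hB.sub huB (hx.trans hωu)) (hx.trans hω) hxC⟩

/-- The transitive set `T ∪ {T, {T, Z}}`. -/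
noncomputable def cap (T Z : V) : V := union (suc T) (upair (upair T Z) (upair T Z))

theorem mem_cap {T Z x : V} : x ∈ᵥ cap T Z ↔ x ∈ᵥ T ∨ x = T ∨ x = upair T Z := by
  simp [cap, or_assoc]

/-! ### The cap and its unique maximal element -/

section Cap

variable {T Z : V} (hT : IsTrans T) (hZ : Z ∈ᵥ T)
include hT hZ

theorem isTrans_cap : IsTrans (cap T Z) := by
  intro x hx y hy
  rw [mem_cap] at hx ⊢
  rcases hx with hx | rfl | rfl
  · exact Or.inl (hT x hx y hy)
  · exact Or.inl hy
  · rcases mem_upair.1 hy with rfl | rfl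
    · exact Or.inr (Or.inl rfl)
    · exact Or.inl hZ

theorem maxIn_cap {x : V} (hx : x ∈ᵥ cap T Z) : MaxIn (cap T Z) x ↔ x = upair T Z := by
  constructor
  · intro h
    rcases mem_cap.1 hx with hx | rfl | rfl
    · exact (h T (mem_cap.2 (by simp)) hx).elim
    · exact (h (upair x Z) (mem_cap.2 (by simp)) (by simp)).elim
    · rfl
  · rintro rfl y hy h
    have hXT : ¬ upair T Z ∈ᵥ T := fun h => not_mem_self T (hT _ h _ (by simp))
    rcases mem_cap.1 hy with hy | rfl | rfl
    · exact hXT (hT y hy _ h)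
    · exact hXT h
    · exact not_mem_self _ h

/-- The maximal element `{T, Z}` is fixed, so `J` maps its two elements among themselves. From `J Z
∈ J T`, the value `J Z = T` would give `T ∈ T` or `T ∈ Z`. -/
theorem IsElemMap.map_cap {j : V} {J : V → V} (h : IsElemMap j (cap T Z) J) : J Z = Z := by
  have hX : upair T Z ∈ᵥ cap T Z := mem_cap.2 (by simp)
  have hTN : T ∈ᵥ cap T Z := mem_cap.2 (by simp)
  have hZN : Z ∈ᵥ cap T Z := mem_cap.2 (Or.inl hZ)
  have hJX : J (upair T Z) = upair T Z :=
    (maxIn_cap hT hZ (h.mem hX)).1 (h.maxIn hX ((maxIn_cap hT hZ hX).2 rfl))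
  have h₁ : J T = T ∨ J T = Z := by
    have := (h.mem_iff hTN hX).1 (by simp)
    rwa [hJX, mem_upair] at this
  have h₂ : J Z = T ∨ J Z = Z := by
    have := (h.mem_iff hZN hX).1 (by simp)
    rwa [hJX, mem_upair] at this
  have h₃ : J Z ∈ᵥ J T := (h.mem_iff hZN hTN).1 hZ
  rcases h₂ with h₂ | h₂
  · rw [h₂] at h₃
    rcases h₁ with h₁ | h₁
    · rw [h₁] at h₃
      exact (not_mem_self T h₃).elim
    · rw [h₁] at h₃
      exact (not_mem_mem hZ h₃).elim
  · exact h₂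

/-- Of the two elements of the maximal set, `T` contains `∅` and so is not an ordered pair; only `Z`
can set the dial. -/
theorem dial_cap {d : V} (h0 : emp V ∈ᵥ T) {y : V} (hZd : Z = opair d y) {k : ℕ} :
    Dial k (cap T Z) ↔ num V k = d := by
  rw [dial_iff (isTrans_cap hT hZ)]
  constructor
  · rintro ⟨x, hx, hm, y', hy⟩
    rw [(maxIn_cap hT hZ hx).1 hm, mem_upair] at hy
    rcases hy with rfl | hy
    · exact (emp_not_mem_opair h0).elim
    · rw [hZd, opair_inj] at hy
      exact hy.1
  · intro h
    have hX : upair T Z ∈ᵥ cap T Z := mem_cap.2 (by simp)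
    exact ⟨_, hX, (maxIn_cap hT hZ hX).2 rfl, y, mem_upair.2 (Or.inr (by rw [hZd, h]))⟩

end Cap

theorem IsCoding.accesses {T M S Z : V} (hc : IsCoding T M S) (hZ : Z ∈ᵥ T)
    (hfix : ∀ (j : V) (J : V → V), IsElemMap j (cap T Z) J → J Z = Z →
      J M = M ∧ J (asgs M) = asgs M ∧ J S = S) :
    Accesses M (cap T Z) := by
  have hT : ∀ {x}, x ∈ᵥ T → x ∈ᵥ cap T Z := fun hx => mem_cap.2 (Or.inl hx)
  refine ⟨fun x hx => hT (hc.sub x hx), fun j hj => ?_⟩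
  obtain ⟨J, hJ⟩ := hj.exists_isElemMap (hT hZ)
  obtain ⟨h₁, h₂, h₃⟩ := hfix j J hJ (hJ.map_cap hc.trans hZ)
  exact hJ.exists_restrict (isTrans_cap hc.trans hZ) (fun n hn => hT (hc.nat hn))
    (fun φ hφ => hT (hc.form hφ)) (hT hc.mem) (hT hc.asgs_mem) (hT hc.satRel_mem) h₁ h₂ h₃ hc.satRel
    fun φ a hφ ha => hT (hc.opair (hc.form hφ) (hc.trans _ hc.asgs_mem _ (mem_asgs.2 ha)))

/-- Any two worlds access a common world with any prescribed value of the dial, which avoids any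
prescribed wild sets that are not yet present. -/
theorem exists_accesses {δ M₁ M₂ C d : V} (h₁ : IsWorld δ M₁) (h₂ : IsWorld δ M₂)
    (hC : ∀ x, x ∈ᵥ C → IsWild x ∧ ¬ x ∈ᵥ M₁ ∧ ¬ x ∈ᵥ M₂) (hd : IsNat d) :
    ∃ N, IsWorld δ N ∧ Accesses M₁ N ∧ Accesses M₂ N ∧ (∀ k, Dial k N ↔ num V k = d) ∧
      (∀ x, x ∈ᵥ C → ¬ x ∈ᵥ N) ∧ ∀ x, Sub x (omg V) → ¬ x ∈ᵥ C → x ∈ᵥ N := by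
  obtain ⟨T, S₁, S₂, c₁, c₂, hTC, hT⟩ := exists_isCoding h₁.1 h₂.1 hC
  have hT₁ := c₁.opair c₁.mem (c₁.opair c₁.asgs_mem c₁.satRel_mem)
  have hT₂ := c₂.opair c₂.mem (c₂.opair c₂.asgs_mem c₂.satRel_mem)
  have hT₃ := c₁.opair hT₁ hT₂
  have hZ := c₁.opair (c₁.nat hd) hT₃
  -- One pair holds the dial value and the codings of both worlds, so fixing `Z` fixes all of them.
  obtain ⟨Z, hZeq⟩ : ∃ Z, Z = opair d (opair (opair M₁ (opair (asgs M₁) S₁))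
    (opair M₂ (opair (asgs M₂) S₂))) := ⟨_, rfl⟩
  rw [← hZeq] at hZ
  have hN := isTrans_cap c₁.trans hZ
  have hTN : ∀ {x}, x ∈ᵥ T → x ∈ᵥ cap T Z := fun hx => mem_cap.2 (Or.inl hx)
  have hfix : ∀ (j : V) (J : V → V), IsElemMap j (cap T Z) J → J Z = Z →
      (J M₁ = M₁ ∧ J (asgs M₁) = asgs M₁ ∧ J S₁ = S₁) ∧
      J M₂ = M₂ ∧ J (asgs M₂) = asgs M₂ ∧ J S₂ = S₂ := by
    intro j J hJ hJZ
    rw [hZeq] at hJZ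
    obtain ⟨-, e⟩ := hJ.map_components hN (hTN (hZeq ▸ hZ)) hJZ
    obtain ⟨e₁, e₂⟩ := hJ.map_components hN (hTN hT₃) e
    obtain ⟨f₁, e₁⟩ := hJ.map_components hN (hTN hT₁) e₁
    obtain ⟨f₂, e₂⟩ := hJ.map_components hN (hTN hT₂) e₂
    exact ⟨⟨f₁, hJ.map_components hN (hTN (c₁.opair c₁.asgs_mem c₁.satRel_mem)) e₁⟩,
      f₂, hJ.map_components hN (hTN (c₂.opair c₂.asgs_mem c₂.satRel_mem)) e₂⟩
  refine ⟨cap T Z, ⟨hN, hTN (c₁.sub _ h₁.2)⟩, c₁.accesses hZ fun j J h h' => (hfix j J h h').1,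
    c₂.accesses hZ fun j J h h' => (hfix j J h h').2,
    fun k => dial_cap c₁.trans hZ (c₁.nat isNat_emp) hZeq, fun x hx hxN => ?_,
    fun x hx hxC => hTN (hT x hx hxC)⟩
  -- Besides `T`, the cap adds a transitive set and an unordered pair, neither of them wild.
  rcases mem_cap.1 hxN with h | rfl | rfl
  · exact hTC x hx h
  · exact (hC x hx).1.not_isTrans c₁.trans
  · exact (hC _ hx).1.ne_upair _ _ rfl

omit hV in
theorem accesses_refl (M : V) : Accesses M M :=
  ⟨fun _ h => h, fun j hj => ⟨j, hj, fun _ _ _ => Iff.rfl⟩⟩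

omit hV in
theorem Accesses.trans {M N K : V} (h₁ : Accesses M N) (h₂ : Accesses N K) : Accesses M K := by
  refine ⟨fun x hx => h₂.1 x (h₁.1 x hx), fun j hj => ?_⟩
  obtain ⟨j', hj', h'⟩ := h₂.2 j hj
  obtain ⟨j'', hj'', h''⟩ := h₁.2 j' hj'
  exact ⟨j'', hj'', fun x hx y => (h'' x hx y).trans (h' x (h₁.1 x hx) y)⟩

theorem exists_common_world {δ M₁ M₂ : V} (h₁ : IsWorld δ M₁) (h₂ : IsWorld δ M₂) :
    ∃ N, IsWorld δ N ∧ Accesses M₁ N ∧ Accesses M₂ N := by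
  obtain ⟨N, hN, h, h', -⟩ := exists_accesses (C := emp V) h₁ h₂
    (fun x hx => (not_mem_emp hx).elim) isNat_emp
  exact ⟨N, hN, h, h'⟩

theorem button_mono {M N : V} (hM : IsTrans M) (hN : IsTrans N) (h : Accesses M N) {k : ℕ}
    (hb : Button k M) : Button k N :=
  (button_iff hN).2 (h.1 _ ((button_iff hM).1 hb))

/-- `I` is an arbitrary external set; the bound `m` keeps the family finite, so pairing and union
suffice and no definability is involved. -/
theorem exists_buttonSets (m : ℕ) (I : Set ℕ) :
    ∃ C : V, ∀ x, x ∈ᵥ C ↔ ∃ k < m, k ∈ I ∧ x = buttonSet V k := by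
  induction m with
  | zero => exact ⟨emp V, fun x => by simp⟩
  | succ m ih =>
    obtain ⟨C, hC⟩ := ih
    by_cases hm : m ∈ I
    · refine ⟨union C (upair (buttonSet V m) (buttonSet V m)), fun x => ?_⟩
      rw [mem_union, hC, mem_upair, or_self]
      constructor
      · rintro (⟨k, hk, h⟩ | rfl)
        · exact ⟨k, by omega, h⟩
        · exact ⟨m, by omega, hm, rfl⟩
      · rintro ⟨k, hk, hI, rfl⟩
        rcases Nat.lt_succ_iff_lt_or_eq.1 hk with hk | rfl
        · exact Or.inl ⟨k, hk, hI, rfl⟩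
        · exact Or.inr rfl
    · refine ⟨C, fun x => (hC x).trans ⟨?_, ?_⟩⟩
      · rintro ⟨k, hk, h⟩
        exact ⟨k, by omega, h⟩
      · rintro ⟨k, hk, hI, rfl⟩
        refine ⟨k, ?_, hI, rfl⟩
        rcases Nat.lt_succ_iff_lt_or_eq.1 hk with hk | rfl
        · exact hk
        · exact (hm hI).elim

variable (V) in
theorem buttonSet_injective {k l : ℕ} (h : buttonSet V k = buttonSet V l) : k = l := by
  have h' : num V (k + 3) ∈ᵥ buttonSet V l := by
    rw [← h, mem_buttonSet]
    simp
  simpa [mem_buttonSet] using h'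

/-- From any world, any of the first `m` buttons may be pushed, leaving the others unchanged,
with any value of the dial. -/
theorem exists_push {δ M : V} (hM : IsWorld δ M) (m : ℕ) (P : Set ℕ)
    (hP : ∀ k, Button k M → k ∈ P) (d : ℕ) :
    ∃ N, IsWorld δ N ∧ Accesses M N ∧ (∀ k, Dial k N ↔ k = d) ∧
      ∀ k < m, Button k N ↔ k ∈ P := by
  -- `C` holds the buttons below `m` that must stay unpushed. Every other button set is a subset of
  -- `ω` outside `C` and therefore enters the new world.
  obtain ⟨C, hC⟩ := exists_buttonSets (V := V) m Pᶜ
  have hC' : ∀ k < m, buttonSet V k ∈ᵥ C ↔ k ∉ P := by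
    intro k hk
    rw [hC]
    constructor
    · rintro ⟨l, -, hl, h⟩
      rwa [buttonSet_injective V h]
    · exact fun h => ⟨k, hk, h, rfl⟩
  obtain ⟨N, hN, h, -, hd, hN₁, hN₂⟩ := exists_accesses (C := C) hM hM (fun x hx => by
    obtain ⟨k, hk, hkP, rfl⟩ := (hC x).1 hx
    have : ¬ buttonSet V k ∈ᵥ M := fun h => hkP (hP k ((button_iff hM.1).2 h))
    exact ⟨isWild_buttonSet k, this, this⟩) (isNat_num d)
  refine ⟨N, hN, h, fun k => by rw [hd, num_inj], fun k hk => ?_⟩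
  rw [button_iff hN.1]
  constructor
  · intro hb
    by_contra hkP
    exact hN₁ _ ((hC' k hk).2 hkP) hb
  · intro hkP
    refine hN₂ _ (fun z hz => ?_) fun hc => (hC' k hk).1 hc hkP
    rcases mem_buttonSet.1 hz with rfl | rfl | rfl <;> exact mem_omg.2 (isNat_num _)

/-- All elements of `δ ∪ {δ}` are transitive, and button sets are not. -/
theorem exists_world_without_buttons {δ : V} (hδ : IsOrd δ) :
    ∃ M, IsWorld δ M ∧ ∀ k, ¬ Button k M := by
  refine ⟨suc δ, ⟨isTrans_suc hδ.1, mem_suc.2 (Or.inr rfl)⟩, fun k hk => ?_⟩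
  rw [button_iff (isTrans_suc hδ.1)] at hk
  refine (isWild_buttonSet (V := V) k).not_isTrans ?_
  rcases mem_suc.1 hk with h | h
  · exact hδ.2 _ h
  · rw [h]; exact hδ.1

end Extension

/-! ### The modal logic of the potentialist system -/

section ModalLogic

variable {V : Type u} [setLang.Structure V]

open ModalFormula PotFormula

/-- Soundness of S4.2. -/
theorem S42.holds [Fact (IsModelZF V)] {δ : V} {φ : ModalFormula} (hφ : S42 φ) {A : Type u}
    (v : A → V) (σ : ℕ → PotFormula A 0) {M : V} (hM : IsWorld δ M) :
    (φ.subst σ).Holds δ v M Fin.elim0 := by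
  induction hφ generalizing M with
  | @taut φ h =>
    exact h (fun ψ => (ψ.subst σ).Holds δ v M Fin.elim0) id fun _ _ => Iff.rfl
  | axK φ ψ => exact fun h h' N hN hMN => h N hN hMN (h' N hN hMN)
  | axDual φ =>
    refine fun h => h (fun h' N hN hMN hf => h' ⟨N, hN, hMN, hf⟩) fun h' => ?_
    rintro ⟨N, hN, hMN, hf⟩
    exact h' N hN hMN hf
  | axS φ => exact fun h => h M hM (accesses_refl M)
  | ax4 φ => exact fun h N hN hMN K hK hNK => h K hK (hMN.trans hNK)
  | axDot2 φ =>
    rintro ⟨N, hN, hMN, h⟩ K hK hMK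
    obtain ⟨L, hL, hNL, hKL⟩ := exists_common_world hN hK
    exact ⟨L, hL, hKL, h L hL hNL⟩
  | mp _ _ h₁ h₂ => exact h₁ hM (h₂ hM)
  | nec _ h => exact fun N hN _ => h hN

/-- A labelling of a frame by the worlds transfers truth of modal formulas. -/
theorem holds_subst_iff_forces {W : Type} [Preorder W] (val : ℕ → W → Prop) {δ : V}
    (s : V → W) (hmono : ∀ M N, IsWorld δ M → IsWorld δ N → Accesses M N → s M ≤ s N)
    (hback : ∀ M, IsWorld δ M → ∀ w, s M ≤ w → ∃ N, IsWorld δ N ∧ Accesses M N ∧ s N = w)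
    {A : Type u} (v : A → V) (σ : ℕ → PotFormula A 0)
    (hσ : ∀ i N, (σ i).Holds δ v N Fin.elim0 ↔ val i (s N)) (φ : ModalFormula) {M : V}
    (hM : IsWorld δ M) :
    (φ.subst σ).Holds δ v M Fin.elim0 ↔ Forces val φ (s M) := by
  induction φ generalizing M with
  | var i => exact hσ i M
  | falsum => exact Iff.rfl
  | imp φ ψ h₁ h₂ => exact imp_congr (h₁ hM) (h₂ hM)
  | box φ ih =>
    constructor
    · intro h w hw
      obtain ⟨N, hN, hMN, rfl⟩ := hback M hM w hw
      exact (ih hN).1 (h N hN hMN)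
    · exact fun h N hN hMN => (ih hN).2 (h _ (hmono M N hM hN hMN))
  | dia φ ih =>
    constructor
    · rintro ⟨N, hN, hMN, h⟩
      exact ⟨_, hmono M N hM hN hMN, (ih hN).1 h⟩
    · rintro ⟨w, hw, h⟩
      obtain ⟨N, hN, hMN, rfl⟩ := hback M hM w hw
      exact ⟨N, hN, hMN, (ih hN).2 h⟩

/-- Completeness of S4.2 for substitutions of pure sentences. -/
theorem S42.of_validPureZF [hV : Fact (IsModelZF V)] {δ : V} (hδ : IsOrd δ) {φ : ModalFormula}
    (h : ValidPureZF δ φ) : S42 φ := by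
  classical
  by_contra hφ
  obtain ⟨W, _, _, r, val, hr, hdir, hval⟩ := exists_finite_countermodel hφ
  obtain ⟨st, hst₀, hstm, hstb⟩ := exists_state_map W r hr hdir
  obtain ⟨m, ⟨f⟩⟩ := Finite.exists_equiv_fin W
  let pushed : (ℕ → Prop) → Set W := fun p => {w | p (f w)}
  -- An arbitrary world may show several dial values or none among the indices of `W`. The choice
  -- made there is harmless: monotonicity of `st` disregards the dial, and every move sets it to one
  -- value.
  let dialed : (ℕ → Prop) → W := fun p =>
    if h : ∃ w, p (f w) then h.choose else r
  have hdial : ∀ (p : ℕ → Prop) (w : W), (∀ k, p k ↔ k = f w) → dialed p = w := by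
    intro p w hp
    have h : ∃ w, p (f w) := ⟨w, (hp _).2 rfl⟩
    simp only [dialed, dif_pos h]
    have := (hp _).1 h.choose_spec
    exact f.injective (Fin.ext this)
  let s : V → W := fun N => st (pushed fun k => Button k N) (dialed fun k => Dial k N)
  have hpush : ∀ M, IsWorld δ M → ∀ (P : Set W) (d : W),
      (pushed fun k => Button k M) ⊆ P →
      ∃ N, IsWorld δ N ∧ Accesses M N ∧ s N = st P d := by
    intro M hM P d hP
    -- Indices not of the form `f w` belong to this set vacuously, so buttons from `m` on that are
    -- already pushed cause no conflict.
    obtain ⟨N, hN, hMN, hd, hb⟩ := exists_push hM m {k | ∀ w : W, (f w : ℕ) = k → w ∈ P}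
      (fun k hk w hw => hP (by simpa only [pushed, Set.mem_ofPred_eq, hw] using hk)) (f d)
    refine ⟨N, hN, hMN, ?_⟩
    have h₁ : (pushed fun k => Button k N) = P := by
      ext w
      have := hb (f w) (f w).2
      simp only [pushed, Set.mem_ofPred_eq, this]
      exact ⟨fun h => h w rfl, fun h w' hw' => f.injective (Fin.ext hw') ▸ h⟩
    simp only [s, h₁, hdial _ d hd]
  have hmono : ∀ M N, IsWorld δ M → IsWorld δ N → Accesses M N → s M ≤ s N :=
    fun M N hM hN hMN => hstm _ _ _ _ fun w hw => button_mono hM.1 hN.1 hMN hw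
  have hback : ∀ M, IsWorld δ M → ∀ w, s M ≤ w →
      ∃ N, IsWorld δ N ∧ Accesses M N ∧ s N = w := by
    intro M hM w hw
    obtain ⟨P, d, hP, rfl⟩ := hstb _ _ _ hw
    exact hpush M hM P d hP
  -- A first move from a button-free world, pushing none of the first `m` buttons and setting the
  -- dial to `r`, reaches a world labelled by the root.
  obtain ⟨M₀, hM₀, hno⟩ := exists_world_without_buttons hδ
  obtain ⟨M, hM, -, hs⟩ := hpush M₀ hM₀ ∅ r fun w hw => hno _ hw
  rw [hst₀] at hs
  have hbut : ∀ k, ∃ ψ : Assertion M, ψ.IsPureZF ∧ ∀ N, ψ.Holds δ Subtype.val N Fin.elim0 ↔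
      Button k N := fun k => by
    obtain ⟨ψ, hψ, h⟩ := (inferInstance :
      Expressible fun (N : V) (_ : Fin 0 → V) => Button k N).out {a : V // a ∈ᵥ M}
    exact ⟨ψ, hψ, fun N => h _ _ _ _⟩
  have hdia : ∀ k, ∃ ψ : Assertion M, ψ.IsPureZF ∧ ∀ N, ψ.Holds δ Subtype.val N Fin.elim0 ↔
      Dial k N := fun k => by
    obtain ⟨ψ, hψ, h⟩ := (inferInstance :
      Expressible fun (N : V) (_ : Fin 0 → V) => Dial k N).out {a : V // a ∈ᵥ M}
    exact ⟨ψ, hψ, fun N => h _ _ _ _⟩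
  choose bs hbs hbs' using hbut
  choose ds hds hds' using hdia
  have hval' : ∀ i, ∃ ψ : Assertion M, ψ.IsPureZF ∧
      ∀ N, ψ.Holds δ Subtype.val N Fin.elim0 ↔ val i (s N) := by
    intro i
    -- The label depends only on `m` buttons and `m` dial statements, so each valuation clause is a
    -- Boolean function of these `m + m` sentences.
    obtain ⟨ψ, hψ, h⟩ := exists_pure_boolean δ (Subtype.val : {a : V // a ∈ᵥ M} → V) (m + m)
      (Fin.append (fun k : Fin m => bs k) fun k : Fin m => ds k)
      (fun k => by
        refine Fin.addCases (fun k => ?_) (fun k => ?_) k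
        · rw [Fin.append_left]; exact hbs k
        · rw [Fin.append_right]; exact hds k)
      (fun p => val i (st {w | p (Fin.castAdd m (f w))}
        (if h : ∃ w, p (Fin.natAdd m (f w)) then h.choose else r)))
    refine ⟨ψ, hψ, fun N => (h N).trans ?_⟩
    simp only [Fin.append_left, Fin.append_right, hbs', hds', s, pushed, dialed]
  choose σ hσ hσ' using hval'
  refine hval (hs ▸ (holds_subst_iff_forces val s hmono hback Subtype.val σ hσ' φ hM).1 ?_)
  exact h M hM σ hσ

end ModalLogic

end Potentialism

theorem mainTheorem1 {V : Type*} [Potentialism.setLang.Structure V]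
    (hV : Potentialism.IsModelZF V) (δ : V) (hδ : Potentialism.IsBerkeley δ) :
    (∀ φ : Potentialism.ModalFormula, Potentialism.Valid δ φ ↔ Potentialism.S42 φ) ∧
    (∀ φ : Potentialism.ModalFormula, Potentialism.ValidPureZF δ φ ↔ Potentialism.S42 φ) := by
  have : Fact (Potentialism.IsModelZF V) := ⟨hV⟩
  have sound : ∀ φ, Potentialism.S42 φ → Potentialism.Valid δ φ := fun φ hφ M hM σ _ =>
    hφ.holds Subtype.val σ hM
  have complete : ∀ φ, Potentialism.ValidPureZF δ φ → Potentialism.S42 φ := fun φ =>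
    Potentialism.S42.of_validPureZF hδ.1.1
  have pure : ∀ φ, Potentialism.Valid δ φ → Potentialism.ValidPureZF δ φ := fun φ h M hM σ _ =>
    h M hM σ fun _ => trivial
  exact ⟨fun φ => ⟨fun h => complete φ (pure φ h), sound φ⟩,
    fun φ => ⟨complete φ, fun h => pure φ (sound φ h)⟩⟩
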